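/- Let $k\ge 0$ be an integer. A sublebesgue measure is a measure $f(x)\,dx$ on $[0,1]$ with $f$ measurable and $0\le f\le 1$ (densities are identified when they agree a.e.). For a binary word $w=w_1\cdots w_n$ let $$\rho_w(f)=n!\int_{0\le x_1<\dots<x_n\le 1}g_1(x_1)\cdots g_n(x_n)\,dx_1\cdots dx_n,\qquad g_i=f\text{ if }w_i=1,\quad g_i=1-f\text{ if }w_i=0.$$ Let $\rho(f)=(\rho_0(f),\rho_{10}(f),\rho_{110}(f),\dots,\rho_{1^k0}(f))$, and let $E_W\subset[0,1]^{k+1}$ be the set of all vectors $\rho(f)$ with $f(x)\,dx$ sublebesgue; interior and boundary of $E_W$ are taken in $\mathbb R^{k+1}$. For such $f$ let $F(x)=\int_0^x f$ and let $H=F^{-1}:[0,F(1)]\to[0,1]$ be the (generalized) inverse distribution function. The entropy of $f$ is $\int_0^1 S(f(x))\,dx$, where $S(q)=-q\log q-(1-q)\log(1-q)$. Let $P_k\cong\mathbb R_{<0}\times\mathbb R^{k}$ be the space of real polynomials of degree at most $k$ with negative constant term, topologized by coefficients. Say that $f$ has shape $p\in P_k$ if $H$ is the genuine inverse of a strictly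 increasing $F$, $p<0$ on $[0,F(1)]$, and $$H'(y)=\frac{1}{1-e^{p(y)}}\qquad (0\le y\le F(1)).$$ 1. For every $\delta$ in the interior of $E_W$ there is, up to a.e. equality, exactly one sublebesgue measure that maximizes the entropy among those with $\rho(f)=\delta$, and it has shape $p$ for some $p\in P_k$. 2. For every $p\in P_k$ there is a sublebesgue measure of shape $p$; its density vector $\rho(f)$ depends only on $p$, and the map $\Phi:p\mapsto\rho(f)$ is a homeomorphism from $P_k$ onto the interior of $E_W$. 3. Every point $\delta$ of the boundary of $E_W$ is $\rho(f)$ for exactly one sublebesgue measure $f(x)\,dx$ (up to a.e. equality), and $f$ is a.e. equal to a $\{0,1\}$-valued step function with at most $k/2+1$ (maximal) intervals on which it takes the value $0$; if there are exactly $k/2+1$ of them, then the first and the last step of $f$ are intervals of value $0$. -/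

import Mathlib

open MeasureTheory Set

noncomputable section

namespace PatternDensity

/-- `f` is the density of a sublebesgue measure `f(x) dx` on `[0,1]`. Two such functions describe
the same measure when they agree almost everywhere on `[0,1]`. -/
def IsSublebesgue (f : ℝ → ℝ) : Prop :=
  Measurable f ∧ ∀ x ∈ Icc (0 : ℝ) 1, f x ∈ Icc (0 : ℝ) 1

/-- Equality of the measures `f(x) dx` and `g(x) dx` on `[0,1]`. -/
def SameMeasure (f g : ℝ → ℝ) : Prop :=
  ∀ᵐ x ∂(volume.restrict (Icc (0 : ℝ) 1)), f x = g x

/-- The density of the pattern `w` (letter `1` is `true`, letter `0` is `false`) in `f(x) dx`: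
`n! ∫_{0 ≤ x₁ < ⋯ < xₙ ≤ 1} g₁(x₁) ⋯ gₙ(xₙ)`, with `gᵢ = f` if `wᵢ = 1` and `gᵢ = 1 - f` if
`wᵢ = 0`. -/
def patternDensity {n : ℕ} (w : Fin n → Bool) (f : ℝ → ℝ) : ℝ :=
  (n.factorial : ℝ) *
    ∫ x in {x : Fin n → ℝ | (∀ i, x i ∈ Icc (0 : ℝ) 1) ∧ StrictMono x},
      ∏ i, (if w i = true then f (x i) else 1 - f (x i))

/-- The pattern `1^i 0`, of length `i + 1`. -/
def onesZero (i : ℕ) : Fin (i + 1) → Bool := fun j => decide ((j : ℕ) < i)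

/-- The vector of densities of the patterns `0, 10, 110, …, 1^k 0`. -/
def densities (k : ℕ) (f : ℝ → ℝ) : Fin (k + 1) → ℝ :=
  fun i => patternDensity (onesZero (i : ℕ)) f

/-- The feasible region for the patterns `0, 10, 110, …, 1^k 0`. -/
def feasible (k : ℕ) : Set (Fin (k + 1) → ℝ) :=
  {δ | (∀ i, δ i ∈ Icc (0 : ℝ) 1) ∧ ∃ f, IsSublebesgue f ∧ densities k f = δ}

/-- The entropy `∫₀¹ S(f(x)) dx`, where `S(p) = -p log p - (1 - p) log (1 - p)`. -/
def entropy (f : ℝ → ℝ) : ℝ := ∫ x in (0 : ℝ)..1, Real.binEntropy (f x)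

/-- `f(x) dx` maximizes the entropy among all sublebesgue measures whose densities of
`0, 10, …, 1^k 0` are `δ`. -/
def IsLimitShape (k : ℕ) (δ : Fin (k + 1) → ℝ) (f : ℝ → ℝ) : Prop :=
  IsSublebesgue f ∧ densities k f = δ ∧
    ∀ g, IsSublebesgue g → densities k g = δ → entropy g ≤ entropy f

/-- The distribution function `F(x) = ∫₀ˣ f`. -/
def distrib (f : ℝ → ℝ) (x : ℝ) : ℝ := ∫ t in (0 : ℝ)..x, f t

/-- The inverse distribution function `H = F⁻¹`, defined on `[0, F(1)]`
(the generalized inverse, which is the inverse when `F` is strictly increasing on `[0,1]`). -/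
def invDistrib (f : ℝ → ℝ) (y : ℝ) : ℝ := sInf {x | x ∈ Icc (0 : ℝ) 1 ∧ y ≤ distrib f x}

/-- Real polynomials of degree at most `k` with negative constant term, as coefficient vectors,
with the topology of `ℝ₋ × ℝᵏ`. -/
abbrev NegPoly (k : ℕ) : Type := {a : Fin (k + 1) → ℝ // a 0 < 0}

/-- The value at `y` of the polynomial with coefficients `a`. -/
def NegPoly.eval {k : ℕ} (a : NegPoly k) (y : ℝ) : ℝ := ∑ i, a.1 i * y ^ (i : ℕ)

/-- The inverse distribution function `H` of `f(x) dx` satisfies `H'(y) = 1 / (1 - e^{p(y)})`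
throughout `[0, F(1)]` (one-sided derivatives at the ends), with `p < 0` there. Together with
`H(0) = 0`, the requirement `H(F(1)) = 1` says that `H` has no jumps, so that `H` is the
genuine inverse of `F : [0,1] → [0, F(1)]`. -/
def HasInverseSlope {k : ℕ} (f : ℝ → ℝ) (p : NegPoly k) : Prop :=
  invDistrib f (distrib f 1) = 1 ∧
    ∀ y ∈ Icc 0 (distrib f 1), p.eval y < 0 ∧
      HasDerivWithinAt (invDistrib f) (1 / (1 - Real.exp (p.eval y))) (Icc 0 (distrib f 1)) y

/-- `f(x) dx` is the `{0,1}`-valued step function on `[0,1]` whose maximal intervals of value `0`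
are, from left to right, the `n` intervals from `s i` to `t i`. -/
def IsZeroOneStep (f : ℝ → ℝ) {n : ℕ} (s t : Fin n → ℝ) : Prop :=
  (∀ i, 0 ≤ s i ∧ s i < t i ∧ t i ≤ 1) ∧ (∀ i j, i < j → t i < s j) ∧
    SameMeasure f ((⋃ i, Ico (s i) (t i))ᶜ.indicator 1)

end PatternDensity

end

open PatternDensity

/-! Everything reduces to a truncated moment problem. Since `F` pushes `f(x) dx` to Lebesgue measure
on `[0, F(1)]`, the density of `1^i 0` is `(i+1) ∫ F^i (1 - f)`. So, with `c = F(1) = 1 - δ 0`, the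
vector `δ` records the moments of order at most `k` of the image `ν` of `(1 - f) dx` under `F`, a
measure on `[0, c]`. These moments form a linear functional `L` on polynomials of degree at most `k`
(`momentFun`, `IsSublebesgue.integral_polyVal`), nonnegative on polynomials that are nonnegative on
`[0, c]`. Interior points are those with `0 < δ 0 < 1` where `L` is strictly positive on the nonzero
ones (`interior_feasible`).

Interior. Gibbs' inequality with comparison value `1 - e^{p(F)}` gives, for every `p < 0` on `[0,
c]`, the bound `entropy f ≤ ∫_0^c -log(1 - e^p) - L(p)`, which sees `f` only through `δ`; equality
holds iff `f = 1 - e^{p(F)}` a.e., that is, iff `f` has shape `p`. Minimizing this convex dual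
functional yields the right `p`: strict positivity of `L` makes it coercive, and a minimizer cannot
touch the constraint `p < 0` because `e^p/(1 - e^p)` has a nonintegrable singularity at a zero of
`p` (`exists_margin`). Stationarity says that the moments of `e^p/(1 - e^p)` are those in `δ`
(`exists_shapeDensities_eq`).

Homeomorphism. A shape determines `H'`, hence `p`; conversely `p` determines the endpoint `c` and
the densities. Continuity both ways comes from compactness: limits are controlled by `exists_margin`
(`IsEndpoint.of_tendsto`), and preimages stay bounded because `-p e^p/(1 - e^p) ≤ 1` while `L` is
coercive uniformly near an interior point.

Boundary. The feasible set is closed, and for `c > 0` a boundary point admits a nonzero `p ≥ 0` on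
`[0, c]` with `L(p) = 0`. Then `ν` lives on the roots of `p`, so `f` is `0` on the corresponding
flat pieces of `F` and `1` elsewhere. Interpolation at the roots recovers `ν` from `δ`, giving
uniqueness; interior roots are double, which bounds the number of flat pieces. -/

namespace PatternDensity

section Distribution

/-! ### The distribution function -/

variable {f : ℝ → ℝ}

theorem IsSublebesgue.intervalIntegrable (hf : IsSublebesgue f) {a b : ℝ}
    (ha : a ∈ Icc (0 : ℝ) 1) (hb : b ∈ Icc (0 : ℝ) 1) : IntervalIntegrable f volume a b := by
  have h1 : IntegrableOn f (Icc (0 : ℝ) 1) := by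
    refine Measure.integrableOn_of_bounded (M := 1) (by simp) hf.1.aestronglyMeasurable ?_
    filter_upwards [ae_restrict_mem measurableSet_Icc] with x hx
    rw [Real.norm_eq_abs, abs_of_nonneg (hf.2 x hx).1]
    exact (hf.2 x hx).2
  exact (h1.mono_set (uIcc_subset_Icc ha hb)).intervalIntegrable

theorem distrib_zero (f : ℝ → ℝ) : distrib f 0 = 0 := by simp [distrib]

theorem IsSublebesgue.distrib_sub (hf : IsSublebesgue f) {a b : ℝ}
    (ha : a ∈ Icc (0 : ℝ) 1) (hb : b ∈ Icc (0 : ℝ) 1) :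
    distrib f b - distrib f a = ∫ t in a..b, f t :=
  intervalIntegral.integral_interval_sub_left (hf.intervalIntegrable (by simp) hb)
    (hf.intervalIntegrable (by simp) ha)

theorem IsSublebesgue.distrib_mono (hf : IsSublebesgue f) {a b : ℝ}
    (ha : 0 ≤ a) (hab : a ≤ b) (hb : b ≤ 1) : distrib f a ≤ distrib f b := by
  rw [← sub_nonneg, hf.distrib_sub ⟨ha, hab.trans hb⟩ ⟨ha.trans hab, hb⟩]
  exact intervalIntegral.integral_nonneg hab fun x hx =>
    (hf.2 x ⟨ha.trans hx.1, hx.2.trans hb⟩).1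

theorem IsSublebesgue.distrib_sub_le (hf : IsSublebesgue f) {a b : ℝ}
    (ha : 0 ≤ a) (hab : a ≤ b) (hb : b ≤ 1) : distrib f b - distrib f a ≤ b - a := by
  rw [hf.distrib_sub ⟨ha, hab.trans hb⟩ ⟨ha.trans hab, hb⟩]
  have h := intervalIntegral.integral_mono_on hab
    (hf.intervalIntegrable ⟨ha, hab.trans hb⟩ ⟨ha.trans hab, hb⟩)
    (intervalIntegrable_const (c := (1 : ℝ)))
    fun x hx => (hf.2 x ⟨ha.trans hx.1, hx.2.trans hb⟩).2
  simpa using h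

theorem IsSublebesgue.distrib_nonneg (hf : IsSublebesgue f) {x : ℝ} (hx : x ∈ Icc (0 : ℝ) 1) :
    0 ≤ distrib f x := by
  simpa [distrib_zero] using hf.distrib_mono le_rfl hx.1 hx.2

theorem IsSublebesgue.distrib_le_self (hf : IsSublebesgue f) {x : ℝ} (hx : x ∈ Icc (0 : ℝ) 1) :
    distrib f x ≤ x := by
  simpa [distrib_zero] using hf.distrib_sub_le le_rfl hx.1 hx.2

theorem IsSublebesgue.distrib_mem (hf : IsSublebesgue f) {x : ℝ} (hx : x ∈ Icc (0 : ℝ) 1) :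
    distrib f x ∈ Icc 0 (distrib f 1) :=
  ⟨hf.distrib_nonneg hx, hf.distrib_mono hx.1 hx.2 le_rfl⟩

theorem IsSublebesgue.lipschitzOnWith_distrib (hf : IsSublebesgue f) :
    LipschitzOnWith 1 (distrib f) (Icc (0 : ℝ) 1) := by
  refine LipschitzOnWith.of_le_add fun x hx y hy => ?_
  rcases le_total x y with h | h
  · linarith [hf.distrib_mono hx.1 h hy.2, dist_nonneg (x := x) (y := y)]
  · rw [Real.dist_eq, abs_of_nonneg (by linarith)]
    linarith [hf.distrib_sub_le hy.1 h hx.2]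

theorem IsSublebesgue.continuousOn_distrib (hf : IsSublebesgue f) :
    ContinuousOn (distrib f) (Icc (0 : ℝ) 1) := hf.lipschitzOnWith_distrib.continuousOn

theorem IsSublebesgue.ae_hasDerivAt_distrib (hf : IsSublebesgue f) :
    ∀ᵐ x, x ∈ Icc (0 : ℝ) 1 → HasDerivAt (distrib f) (f x) x := by
  have h := (hf.intervalIntegrable (a := 0) (b := 1) (by simp) (by simp)).ae_hasDerivAt_integral
  filter_upwards [h] with x hx hx1
  exact hx (by rwa [uIcc_of_le zero_le_one]) 0 (by simp)

/-- The distribution function pushes `f(x) dx` forward to Lebesgue measure. -/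
theorem IsSublebesgue.integral_comp_distrib_mul (hf : IsSublebesgue f) {φ : ℝ → ℝ}
    (hφ : Continuous φ) {x : ℝ} (hx : x ∈ Icc (0 : ℝ) 1) :
    ∫ t in (0 : ℝ)..x, φ (distrib f t) * f t = ∫ y in (0 : ℝ)..distrib f x, φ y := by
  set Φ : ℝ → ℝ := fun y => ∫ u in (0 : ℝ)..y, φ u with hΦ
  have hd : ∀ y, HasDerivAt Φ (φ y) y := fun y => hφ.integral_hasStrictDerivAt 0 y |>.hasDerivAt
  obtain ⟨C, hC⟩ := isCompact_Icc.exists_bound_of_continuousOn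
    (s := Icc (0 : ℝ) 1) hφ.continuousOn
  have hC0 : 0 ≤ C := (norm_nonneg _).trans (hC 0 (by simp))
  have hL : LipschitzOnWith (Real.toNNReal C) Φ (Icc (0 : ℝ) 1) := by
    refine (convex_Icc 0 1).lipschitzOnWith_of_nnnorm_hasDerivWithin_le (𝕜 := ℝ)
      (fun y _ => (hd y).hasDerivWithinAt) fun y hy => ?_
    rw [← NNReal.coe_le_coe, coe_nnnorm, Real.coe_toNNReal _ hC0]
    exact hC y hy
  have hmaps : MapsTo (distrib f) (Icc (0 : ℝ) 1) (Icc (0 : ℝ) 1) := fun t ht =>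
    ⟨hf.distrib_nonneg ht, (hf.distrib_le_self ht).trans ht.2⟩
  -- As `f` is only measurable, the chain rule holds only a.e.; absolute continuity of the Lipschitz
  -- composite is what makes the fundamental theorem applicable.
  have hac : AbsolutelyContinuousOnInterval (Φ ∘ distrib f) 0 x :=
    ((hL.comp hf.lipschitzOnWith_distrib hmaps).mono
      (uIcc_subset_Icc (by simp) hx)).absolutelyContinuousOnInterval
  have h := hac.integral_deriv_eq_sub
  have h2 : Φ 0 = 0 := by simp [hΦ]
  simp only [Function.comp, distrib_zero, h2, sub_zero] at h
  refine Eq.trans (intervalIntegral.integral_congr_ae ?_) h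
  filter_upwards [hf.ae_hasDerivAt_distrib] with t ht htx
  rw [uIoc_of_le hx.1] at htx
  exact (((hd _).comp t (ht ⟨htx.1.le, htx.2.trans hx.2⟩)).deriv).symm

theorem IsSublebesgue.intervalIntegrable_comp_distrib_mul (hf : IsSublebesgue f) {φ : ℝ → ℝ}
    (hφ : ContinuousOn φ (Icc 0 (distrib f 1))) {g : ℝ → ℝ} (hg : IsSublebesgue g) :
    IntervalIntegrable (fun t => φ (distrib f t) * g t) volume 0 1 := by
  refine (hg.intervalIntegrable (by simp) (by simp)).continuousOn_mul ?_
  rw [uIcc_of_le zero_le_one]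
  exact hφ.comp hf.continuousOn_distrib fun t ht => hf.distrib_mem ht

theorem IsSublebesgue.one_sub (hf : IsSublebesgue f) : IsSublebesgue fun x => 1 - f x :=
  ⟨measurable_const.sub hf.1, fun x hx =>
    ⟨by linarith [(hf.2 x hx).2], by linarith [(hf.2 x hx).1]⟩⟩

/-! ### Pattern densities as moments -/

/-- Strictly increasing `n`-tuples in `[0, t)`. -/
def openSimplex (n : ℕ) (t : ℝ) : Set (Fin n → ℝ) :=
  {x | (∀ i, x i ∈ Ico 0 t) ∧ StrictMono x}

theorem measurableSet_strictMono (n : ℕ) : MeasurableSet {x : Fin n → ℝ | StrictMono x} := by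
  have : {x : Fin n → ℝ | StrictMono x} = ⋂ i, ⋂ j, ⋂ (_ : i < j), {x | x i < x j} := by
    ext x; simp only [mem_ofPred_eq, mem_iInter, StrictMono]
  rw [this]
  exact MeasurableSet.iInter fun i => MeasurableSet.iInter fun j => MeasurableSet.iInter fun _ =>
    measurableSet_lt (measurable_pi_apply i) (measurable_pi_apply j)

theorem measurableSet_cube (n : ℕ) {J : Set ℝ} (hJ : MeasurableSet J) :
    MeasurableSet {x : Fin n → ℝ | ∀ i, x i ∈ J} := by
  simp only [ofPred_forall]
  exact MeasurableSet.iInter fun i => measurable_pi_apply i hJ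

theorem strictMono_iff_castSucc_last {n : ℕ} (x : Fin (n + 1) → ℝ) :
    StrictMono x ↔ (∀ i : Fin n, x i.castSucc < x (Fin.last n)) ∧
      StrictMono fun i : Fin n => x i.castSucc := by
  constructor
  · exact fun h => ⟨fun i => h (Fin.castSucc_lt_last i),
      fun i j hij => h (Fin.castSucc_lt_castSucc_iff.2 hij)⟩
  · rintro ⟨h1, h2⟩ i j hij
    induction j using Fin.lastCases with
    | last =>
      induction i using Fin.lastCases with
      | last => exact absurd hij (lt_irrefl _)
      | cast i => exact h1 i
    | cast j =>
      induction i using Fin.lastCases with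
      | last => exact absurd (hij.trans (Fin.castSucc_lt_last j)) (lt_irrefl _)
      | cast i => exact h2 (Fin.castSucc_lt_castSucc_iff.1 hij)

/-- Fubini, peeling off the largest coordinate. `J` is left general to serve both `Ico 0 t`
(induction for the simplex volume) and `Icc 0 1` (pattern densities); the last factor has its own
function `g` because the last letter of `1^i 0` differs from the others. -/
theorem integral_strictMono_succ (n : ℕ) {J : Set ℝ} (hJ : MeasurableSet J)
    (hJ1 : J ⊆ Icc 0 1) (hJc : ∀ t ∈ J, Ico 0 t ⊆ J) {h g : ℝ → ℝ} (hh : IsSublebesgue h)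
    (hg : IsSublebesgue g) :
    ∫ x in {x : Fin (n + 1) → ℝ | (∀ i, x i ∈ J) ∧ StrictMono x},
        (∏ i : Fin n, h (x i.castSucc)) * g (x (Fin.last n)) =
      ∫ t in J, g t * ∫ y in openSimplex n t, ∏ i, h (y i) := by
  set S := {x : Fin (n + 1) → ℝ | (∀ i, x i ∈ J) ∧ StrictMono x} with hS
  set G : (Fin (n + 1) → ℝ) → ℝ :=
    fun x => (∏ i : Fin n, h (x i.castSucc)) * g (x (Fin.last n)) with hG
  have hSm : MeasurableSet S := (measurableSet_cube _ hJ).inter (measurableSet_strictMono _)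
  have hGm : Measurable G :=
    (Finset.measurable_prod _ fun i _ => hh.1.comp (measurable_pi_apply _)).mul
      (hg.1.comp (measurable_pi_apply _))
  have hSfin : volume S < ⊤ := by
    refine lt_of_le_of_lt (measure_mono (t := Icc (0 : Fin (n + 1) → ℝ) 1) ?_)
      isCompact_Icc.measure_lt_top
    exact fun x hx => ⟨fun i => (hJ1 (hx.1 i)).1, fun i => (hJ1 (hx.1 i)).2⟩
  have hGi : Integrable (S.indicator G) := by
    rw [integrable_indicator_iff hSm]
    refine Measure.integrableOn_of_bounded (M := 1) hSfin.ne hGm.aestronglyMeasurable ?_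
    filter_upwards [ae_restrict_mem hSm] with x hx
    have h1 : ∀ i, x i ∈ Icc (0 : ℝ) 1 := fun i => hJ1 (hx.1 i)
    have h2 : 0 ≤ ∏ i : Fin n, h (x i.castSucc) :=
      Finset.prod_nonneg fun i _ => (hh.2 _ (h1 _)).1
    rw [Real.norm_eq_abs, abs_of_nonneg (mul_nonneg h2 (hg.2 _ (h1 _)).1)]
    exact mul_le_one₀ (Finset.prod_le_one (fun i _ => (hh.2 _ (h1 _)).1)
      fun i _ => (hh.2 _ (h1 _)).2) (hg.2 _ (h1 _)).1 (hg.2 _ (h1 _)).2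
  have mp := (volume_preserving_piFinSuccAbove (fun _ : Fin (n + 1) => ℝ) (Fin.last n)).symm
  have hint : Integrable ((S.indicator G) ∘
      (MeasurableEquiv.piFinSuccAbove (fun _ : Fin (n + 1) => ℝ) (Fin.last n)).symm) :=
    (mp.integrable_comp_emb (MeasurableEquiv.measurableEmbedding _)).2 hGi
  rw [← integral_indicator hSm, ← mp.integral_comp', ← integral_indicator hJ]
  rw [Measure.volume_eq_prod] at hint ⊢
  refine (integral_prod _ hint).trans (integral_congr_ae (Filter.Eventually.of_forall fun t => ?_))
  have key : ∀ y : Fin n → ℝ, S.indicator G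
      ((MeasurableEquiv.piFinSuccAbove (fun _ : Fin (n + 1) => ℝ) (Fin.last n)).symm (t, y)) =
      J.indicator g t * (openSimplex n t).indicator (fun y => ∏ i, h (y i)) y := by
    intro y
    have e1 : (MeasurableEquiv.piFinSuccAbove (fun _ : Fin (n + 1) => ℝ) (Fin.last n)).symm
        (t, y) = (Fin.last n).insertNth t y := rfl
    rw [e1]
    set x : Fin (n + 1) → ℝ := (Fin.last n).insertNth t y with hx
    have x1 : x (Fin.last n) = t := Fin.insertNth_apply_same (α := fun _ => ℝ) _ _ _
    have x2 : ∀ i : Fin n, x i.castSucc = y i := fun i => by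
      rw [← Fin.succAbove_last_apply]
      exact Fin.insertNth_apply_succAbove (α := fun _ => ℝ) _ _ _ _
    have hmem : x ∈ S ↔ t ∈ J ∧ y ∈ openSimplex n t := by
      simp only [hS, mem_ofPred_eq, strictMono_iff_castSucc_last, x1, x2, openSimplex]
      rw [Fin.forall_fin_succ']
      simp only [x1, x2]
      constructor
      · rintro ⟨⟨h1, h2⟩, h3, h4⟩
        exact ⟨h2, fun i => ⟨(hJ1 (h1 i)).1, h3 i⟩, h4⟩
      · rintro ⟨h1, h2, h3⟩
        exact ⟨⟨fun i => hJc t h1 (h2 i), h1⟩, fun i => (h2 i).2, h3⟩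
    by_cases hxS : x ∈ S
    · rw [indicator_of_mem hxS, indicator_of_mem (hmem.1 hxS).1, indicator_of_mem (hmem.1 hxS).2]
      simp only [hG, x1, x2, mul_comm]
    · rw [indicator_of_notMem hxS]
      by_cases ht : t ∈ J
      · rw [indicator_of_notMem (fun hy => hxS (hmem.2 ⟨ht, hy⟩)), mul_zero]
      · rw [indicator_of_notMem ht, zero_mul]
  simp only [Function.comp, key]
  rw [integral_const_mul, integral_indicator]
  · by_cases ht : t ∈ J <;> simp [ht]
  · exact (measurableSet_cube _ measurableSet_Ico).inter (measurableSet_strictMono _)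

theorem IsSublebesgue.integral_openSimplex (hf : IsSublebesgue f) (n : ℕ) :
    ∀ t ∈ Icc (0 : ℝ) 1, ∫ y in openSimplex n t, ∏ i, f (y i) =
      distrib f t ^ n / n.factorial := by
  induction n with
  | zero =>
    intro t _
    have : openSimplex 0 t = univ := by
      ext x; simp [openSimplex, Subsingleton.strictMono]
    simp [this, integral_const, Measure.real, Measure.volume_pi_eq_dirac (0 : Fin 0 → ℝ)]
  | succ n ih =>
    intro t ht
    have h := integral_strictMono_succ n (J := Ico 0 t) measurableSet_Ico
      (fun x hx => ⟨hx.1, hx.2.le.trans ht.2⟩)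
      (fun s hs x hx => ⟨hx.1, hx.2.trans hs.2⟩) hf hf
    simp only [openSimplex, Fin.prod_univ_castSucc]
    rw [h]
    have h3 : ∫ s in Ico 0 t, f s * ∫ y in openSimplex n s, ∏ i, f (y i) =
        ∫ s in Ico 0 t, (n.factorial : ℝ)⁻¹ * (distrib f s ^ n * f s) := by
      refine setIntegral_congr_fun measurableSet_Ico fun s hs => ?_
      rw [ih s ⟨hs.1, hs.2.le.trans ht.2⟩]
      ring
    rw [h3, integral_const_mul, ← integral_Icc_eq_integral_Ico, integral_Icc_eq_integral_Ioc,
      ← intervalIntegral.integral_of_le ht.1,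
      hf.integral_comp_distrib_mul (φ := fun y => y ^ n) (by fun_prop) ht, integral_pow,
      Nat.factorial_succ]
    push_cast
    field_simp
    simp

theorem IsSublebesgue.densities_eq (hf : IsSublebesgue f) {k : ℕ} (i : Fin (k + 1)) :
    densities k f i = ((i : ℕ) + 1) * ∫ x in (0 : ℝ)..1, distrib f x ^ (i : ℕ) * (1 - f x) := by
  set n : ℕ := (i : ℕ)
  have h := integral_strictMono_succ n (J := Icc 0 1) measurableSet_Icc subset_rfl
      (fun s hs x hx => ⟨hx.1, hx.2.le.trans hs.2⟩) hf hf.one_sub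
  have h1 : ∀ x : Fin (n + 1) → ℝ, (∏ j, if onesZero n j = true then f (x j) else 1 - f (x j)) =
      (∏ j : Fin n, f (x j.castSucc)) * (1 - f (x (Fin.last n))) := by
    intro x
    rw [Fin.prod_univ_castSucc]
    simp [onesZero]
  have h3 : ∫ t in Icc (0 : ℝ) 1, (1 - f t) * ∫ y in openSimplex n t, ∏ i, f (y i) =
      ∫ t in Icc (0 : ℝ) 1, (n.factorial : ℝ)⁻¹ * (distrib f t ^ n * (1 - f t)) := by
    refine setIntegral_congr_fun measurableSet_Icc fun s hs => ?_
    rw [hf.integral_openSimplex n s hs]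
    ring
  change patternDensity (onesZero n) f = _
  simp only [patternDensity, h1]
  rw [h, h3, integral_const_mul, integral_Icc_eq_integral_Ioc,
    ← intervalIntegral.integral_of_le zero_le_one, Nat.factorial_succ]
  push_cast
  field_simp

end Distribution

section Compactness

/-! ### The feasible region is compact -/

theorem SameMeasure.symm {f g : ℝ → ℝ} (h : SameMeasure f g) : SameMeasure g f := by
  filter_upwards [h] with x hx using hx.symm

theorem SameMeasure.trans {f g h : ℝ → ℝ} (h1 : SameMeasure f g) (h2 : SameMeasure g h) :
    SameMeasure f h := by
  filter_upwards [h1, h2] with x hx hx' using hx.trans hx'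

theorem sameMeasure_of_distrib_eq {f g : ℝ → ℝ} (hf : IsSublebesgue f) (hg : IsSublebesgue g)
    (h : ∀ x ∈ Icc (0 : ℝ) 1, distrib f x = distrib g x) : SameMeasure f g := by
  have h0 : ∀ᵐ x : ℝ, x ≠ 0 := by simp [ae_iff, measure_singleton]
  have h1 : ∀ᵐ x : ℝ, x ≠ 1 := by simp [ae_iff, measure_singleton]
  rw [SameMeasure, ae_restrict_iff' measurableSet_Icc]
  filter_upwards [hf.ae_hasDerivAt_distrib, hg.ae_hasDerivAt_distrib, h0, h1]
    with x hx hx' hx0 hx1 hxI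
  refine (hx hxI).unique ((hx' hxI).congr_of_eventuallyEq ?_)
  filter_upwards [Ioo_mem_nhds (lt_of_le_of_ne hxI.1 hx0.symm) (lt_of_le_of_ne hxI.2 hx1)]
    with y hy using h y ⟨hy.1.le, hy.2.le⟩

theorem exists_distrib_eq {G : ℝ → ℝ} (hm : Monotone G) (hL : LipschitzWith 1 G) (h0 : G 0 = 0) :
    ∃ f, IsSublebesgue f ∧ ∀ x, distrib f x = G x := by
  -- `deriv` is `0` where `G` is not differentiable, so the bounds hold at every point and not
  -- merely almost everywhere.
  refine ⟨deriv G, ⟨measurable_deriv G, fun x _ => ⟨hm.deriv_nonneg, ?_⟩⟩, fun x => ?_⟩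
  · have := norm_deriv_le_of_lipschitz (x₀ := x) hL
    exact (le_abs_self _).trans (by simpa using this)
  · rw [distrib, ((hL.lipschitzOnWith).absolutelyContinuousOnInterval).integral_deriv_eq_sub, h0,
      sub_zero]

variable {f : ℝ → ℝ}

/-- Here `f` enters only through its distribution function, and continuously for the sup norm; this
is what makes the Arzelà–Ascoli compactness of `distribSet` useful. -/
theorem IsSublebesgue.densities_eq_sub (hf : IsSublebesgue f) {k : ℕ} (i : Fin (k + 1)) :
    densities k f i = ((i : ℕ) + 1) * (∫ x in (0 : ℝ)..1, distrib f x ^ (i : ℕ)) -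
      distrib f 1 ^ ((i : ℕ) + 1) := by
  have h1 := hf.integral_comp_distrib_mul (φ := fun y => y ^ (i : ℕ)) (by fun_prop)
    (x := 1) (by simp)
  rw [integral_pow] at h1
  have hc : ContinuousOn (fun x => distrib f x ^ (i : ℕ)) (uIcc 0 1) := by
    rw [uIcc_of_le zero_le_one]; exact hf.continuousOn_distrib.pow _
  have h2 := intervalIntegral.integral_sub (μ := volume) hc.intervalIntegrable
    (hf.intervalIntegrable_comp_distrib_mul (φ := fun y => y ^ (i : ℕ)) (by fun_prop) hf)
  rw [hf.densities_eq]
  have h3 : ∫ x in (0 : ℝ)..1, distrib f x ^ (i : ℕ) * (1 - f x) =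
      ∫ x in (0 : ℝ)..1, (distrib f x ^ (i : ℕ) - distrib f x ^ (i : ℕ) * f x) := by
    congr 1; ext x; ring
  rw [h3, h2, h1]
  field_simp
  simp

theorem IsSublebesgue.densities_zero (hf : IsSublebesgue f) (k : ℕ) :
    densities k f 0 = 1 - distrib f 1 := by
  rw [hf.densities_eq_sub]; simp

theorem IsSublebesgue.distrib_one (hf : IsSublebesgue f) (k : ℕ) :
    distrib f 1 = 1 - densities k f 0 := by
  rw [hf.densities_zero]; ring

theorem IsSublebesgue.densities_mem (hf : IsSublebesgue f) {k : ℕ} (i : Fin (k + 1)) :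
    densities k f i ∈ Icc (0 : ℝ) 1 := by
  rw [hf.densities_eq]
  constructor
  · refine mul_nonneg (by positivity) (intervalIntegral.integral_nonneg zero_le_one fun x hx => ?_)
    exact mul_nonneg (pow_nonneg (hf.distrib_nonneg hx) _) (hf.one_sub.2 x hx).1
  · have h : ∫ x in (0 : ℝ)..1, distrib f x ^ (i : ℕ) * (1 - f x) ≤
        ∫ x in (0 : ℝ)..1, x ^ (i : ℕ) := by
      refine intervalIntegral.integral_mono_on zero_le_one
        (hf.intervalIntegrable_comp_distrib_mul (φ := fun y => y ^ (i : ℕ)) (by fun_prop)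
          hf.one_sub) ((continuous_pow _).intervalIntegrable _ _) fun x hx => ?_
      have h1 := pow_le_pow_left₀ (hf.distrib_nonneg hx) (hf.distrib_le_self hx) (i : ℕ)
      have h2 := pow_nonneg (hf.distrib_nonneg hx) (i : ℕ)
      nlinarith [(hf.one_sub.2 x hx).1, (hf.one_sub.2 x hx).2, pow_nonneg hx.1 (i : ℕ)]
    rw [integral_pow] at h
    calc _ ≤ (((i : ℕ) : ℝ) + 1) * ((1 ^ ((i : ℕ) + 1) - 0 ^ ((i : ℕ) + 1)) / ((i : ℕ) + 1)) :=
          mul_le_mul_of_nonneg_left h (by positivity)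
      _ = 1 := by field_simp; simp

theorem mem_feasible {k : ℕ} {δ : Fin (k + 1) → ℝ} :
    δ ∈ feasible k ↔ ∃ f, IsSublebesgue f ∧ densities k f = δ :=
  ⟨fun h => h.2, fun ⟨f, hf, hd⟩ => ⟨fun i => hd ▸ hf.densities_mem i, f, hf, hd⟩⟩

/-- Restrictions to `[0,1]` of distribution functions of sublebesgue measures. -/
def distribSet : Set (BoundedContinuousFunction (Icc (0 : ℝ) 1) ℝ) :=
  {F | F 0 = 0 ∧ ∀ x y : Icc (0 : ℝ) 1, x ≤ y → 0 ≤ F y - F x ∧ F y - F x ≤ y - x}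

theorem lipschitzWith_of_mem_distribSet {F : BoundedContinuousFunction (Icc (0 : ℝ) 1) ℝ}
    (hF : F ∈ distribSet) : LipschitzWith 1 F := by
  refine LipschitzWith.of_le_add fun x y => ?_
  rcases le_total x y with h | h
  · linarith [(hF.2 x y h).1, dist_nonneg (x := x) (y := y)]
  · have := (hF.2 y x h).2
    rw [Subtype.dist_eq, Real.dist_eq, abs_of_nonneg (by linarith [(hF.2 y x h).1])]
    linarith

theorem isCompact_distribSet : IsCompact distribSet := by
  refine BoundedContinuousFunction.arzela_ascoli₂ (Icc (0 : ℝ) 1) isCompact_Icc _ ?_ ?_ ?_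
  · have e : ∀ x : Icc (0 : ℝ) 1,
        Continuous fun F : BoundedContinuousFunction (Icc (0 : ℝ) 1) ℝ => F x := fun x =>
      continuous_eval_const x
    simp only [distribSet, ofPred_and, ofPred_forall]
    refine (isClosed_eq (e 0) continuous_const).inter ?_
    refine isClosed_iInter fun x => isClosed_iInter fun y => isClosed_iInter fun _ => ?_
    exact (isClosed_le continuous_const ((e y).sub (e x))).inter
      (isClosed_le ((e y).sub (e x)) continuous_const)
  · intro F x hF
    have h := hF.2 0 x x.2.1
    rw [hF.1] at h
    have hx : (x : ℝ) ≤ 1 := x.2.2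
    simp only [Icc.coe_zero, sub_zero] at h
    exact ⟨h.1, h.2.trans hx⟩
  · exact (LipschitzWith.uniformEquicontinuous _ 1
      fun F => lipschitzWith_of_mem_distribSet F.2).equicontinuous

/-- The density vector in terms of the distribution function. -/
noncomputable def distribDensities (k : ℕ) (F : BoundedContinuousFunction (Icc (0 : ℝ) 1) ℝ) :
    Fin (k + 1) → ℝ := fun i =>
  ((i : ℕ) + 1) * (∫ x in (0 : ℝ)..1, F (projIcc 0 1 zero_le_one x) ^ (i : ℕ)) -
    F 1 ^ ((i : ℕ) + 1)

theorem continuous_distribDensities (k : ℕ) : Continuous (distribDensities k) := by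
  refine continuous_pi fun i => ?_
  refine (continuous_const.mul ?_).sub
    ((continuous_eval_const (1 : Icc (0 : ℝ) 1)).pow _)
  refine intervalIntegral.continuous_parametric_intervalIntegral_of_continuous' ?_ 0 1
  have h : Continuous fun q : BoundedContinuousFunction (Icc (0 : ℝ) 1) ℝ × ℝ =>
      q.1 (projIcc 0 1 zero_le_one q.2) :=
    Continuous.eval continuous_fst
      (continuous_projIcc.comp continuous_snd)
  exact h.pow _

theorem densities_eq_distribDensities (hf : IsSublebesgue f) {k : ℕ}
    {F : BoundedContinuousFunction (Icc (0 : ℝ) 1) ℝ}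
    (h : ∀ x : Icc (0 : ℝ) 1, distrib f x = F x) :
    densities k f = distribDensities k F := by
  ext i
  rw [hf.densities_eq_sub, distribDensities, ← h 1]
  congr 2
  refine intervalIntegral.integral_congr fun x hx => ?_
  rw [uIcc_of_le zero_le_one] at hx
  rw [← h, projIcc_of_mem _ hx]

theorem feasible_eq_image (k : ℕ) : feasible k = distribDensities k '' distribSet := by
  ext δ
  rw [mem_feasible]
  constructor
  · rintro ⟨f, hf, rfl⟩
    let F : BoundedContinuousFunction (Icc (0 : ℝ) 1) ℝ :=
      BoundedContinuousFunction.mkOfCompact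
        ⟨fun x => distrib f x, continuousOn_iff_continuous_domRestrict.1 hf.continuousOn_distrib⟩
    refine ⟨F, ⟨distrib_zero f, fun x y hxy => ⟨?_, ?_⟩⟩,
      (densities_eq_distribDensities hf fun x => rfl).symm⟩
    · exact sub_nonneg.2 (hf.distrib_mono x.2.1 hxy y.2.2)
    · exact hf.distrib_sub_le x.2.1 hxy y.2.2
  · rintro ⟨F, hF, rfl⟩
    obtain ⟨f, hf, hfG⟩ := exists_distrib_eq (G := fun x => F (projIcc 0 1 zero_le_one x))
      (fun x y hxy => sub_nonneg.1 (hF.2 _ _ (monotone_projIcc _ hxy)).1)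
      (by simpa [Function.comp_def] using
        (lipschitzWith_of_mem_distribSet hF).comp (LipschitzWith.projIcc zero_le_one))
      (by rw [projIcc_left]; exact hF.1)
    refine ⟨f, hf, densities_eq_distribDensities hf fun x => ?_⟩
    rw [hfG, projIcc_val]

theorem isClosed_feasible (k : ℕ) : IsClosed (feasible k) := by
  rw [feasible_eq_image]
  exact (isCompact_distribSet.image (continuous_distribDensities k)).isClosed

/-! ### Polynomials and moments -/

/-- The value at `y` of the polynomial with coefficients `a`. -/
noncomputable def polyVal {k : ℕ} (a : Fin (k + 1) → ℝ) (y : ℝ) : ℝ := ∑ i, a i * y ^ (i : ℕ)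

/-- The functional sending `y ^ i` to `δ i / (i + 1)`. -/
noncomputable def momentFun {k : ℕ} (δ a : Fin (k + 1) → ℝ) : ℝ := ∑ i, a i * (δ i / ((i : ℕ) + 1))

theorem continuous_polyVal {k : ℕ} :
    Continuous fun q : (Fin (k + 1) → ℝ) × ℝ => polyVal q.1 q.2 := by
  unfold polyVal; fun_prop

theorem continuous_polyVal_right {k : ℕ} (a : Fin (k + 1) → ℝ) : Continuous (polyVal a) := by
  unfold polyVal; fun_prop

theorem continuous_momentFun {k : ℕ} :
    Continuous fun q : (Fin (k + 1) → ℝ) × (Fin (k + 1) → ℝ) => momentFun q.1 q.2 := by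
  unfold momentFun; fun_prop

theorem polyVal_zero_right {k : ℕ} (a : Fin (k + 1) → ℝ) : polyVal a 0 = a 0 := by
  rw [polyVal, Fin.sum_univ_succ]; simp

theorem polyVal_add {k : ℕ} (a b : Fin (k + 1) → ℝ) (y : ℝ) :
    polyVal (a + b) y = polyVal a y + polyVal b y := by
  simp [polyVal, add_mul, Finset.sum_add_distrib]

theorem polyVal_smul {k : ℕ} (t : ℝ) (a : Fin (k + 1) → ℝ) (y : ℝ) :
    polyVal (t • a) y = t * polyVal a y := by
  simp [polyVal, Finset.mul_sum, mul_assoc]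

theorem polyVal_neg {k : ℕ} (a : Fin (k + 1) → ℝ) (y : ℝ) : polyVal (-a) y = -polyVal a y := by
  simp [polyVal]

theorem polyVal_single {k : ℕ} (i : Fin (k + 1)) (t y : ℝ) :
    polyVal (Pi.single i t) y = t * y ^ (i : ℕ) := by
  rw [polyVal, Finset.sum_eq_single i] <;> simp +contextual [Pi.single_eq_of_ne]

theorem momentFun_add {k : ℕ} (δ a b : Fin (k + 1) → ℝ) :
    momentFun δ (a + b) = momentFun δ a + momentFun δ b := by
  simp [momentFun, add_mul, Finset.sum_add_distrib]

theorem momentFun_smul {k : ℕ} (δ : Fin (k + 1) → ℝ) (t : ℝ) (a : Fin (k + 1) → ℝ) :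
    momentFun δ (t • a) = t * momentFun δ a := by
  simp [momentFun, Finset.mul_sum, mul_assoc]

theorem momentFun_neg {k : ℕ} (δ a : Fin (k + 1) → ℝ) : momentFun δ (-a) = -momentFun δ a := by
  simp [momentFun]

theorem momentFun_single {k : ℕ} (δ : Fin (k + 1) → ℝ) (i : Fin (k + 1)) (t : ℝ) :
    momentFun δ (Pi.single i t) = t * (δ i / ((i : ℕ) + 1)) := by
  rw [momentFun, Finset.sum_eq_single i] <;> simp +contextual [Pi.single_eq_of_ne]

/-- Identifies `momentFun` as integration against the image of `(1 - f) dx` under the distribution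
function; every later positivity argument rests on this. -/
theorem IsSublebesgue.integral_polyVal (hf : IsSublebesgue f) {k : ℕ} (a : Fin (k + 1) → ℝ) :
    ∫ x in (0 : ℝ)..1, polyVal a (distrib f x) * (1 - f x) = momentFun (densities k f) a := by
  have h : ∀ x, polyVal a (distrib f x) * (1 - f x) =
      ∑ i : Fin (k + 1), a i * (distrib f x ^ (i : ℕ) * (1 - f x)) := fun x => by
    simp [polyVal, Finset.sum_mul, mul_assoc]
  simp only [h]
  rw [intervalIntegral.integral_finsetSum]
  · refine Finset.sum_congr rfl fun i _ => ?_
    rw [intervalIntegral.integral_const_mul, hf.densities_eq]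
    field_simp
  · exact fun i _ => (hf.intervalIntegrable_comp_distrib_mul (φ := fun y => y ^ (i : ℕ))
      (by fun_prop) hf.one_sub).const_mul _

end Compactness

section Endpoint

open Filter Topology

/-! ### The function `exp u / (1 - exp u)` -/

/-- The Bose function `exp u / (1 - exp u)`. -/
noncomputable def bose (u : ℝ) : ℝ := Real.exp u / (1 - Real.exp u)

theorem one_sub_exp_pos {u : ℝ} (hu : u < 0) : 0 < 1 - Real.exp u := by
  have := Real.exp_lt_exp.2 hu; rw [Real.exp_zero] at this; linarith

theorem bose_pos {u : ℝ} (hu : u < 0) : 0 < bose u :=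
  div_pos (Real.exp_pos u) (one_sub_exp_pos hu)

theorem one_add_bose {u : ℝ} (hu : u < 0) : 1 + bose u = 1 / (1 - Real.exp u) := by
  have := (one_sub_exp_pos hu).ne'
  rw [bose]; field_simp; ring

/-- Gives the a priori bound on the coefficients of `p` in terms of its densities, in
`norm_le_of_coercive`. -/
theorem neg_mul_bose_le {u : ℝ} (hu : u < 0) : -u * bose u ≤ 1 := by
  rw [bose, ← mul_div_assoc, div_le_one (one_sub_exp_pos hu)]
  have h1 := Real.add_one_le_exp (-u)
  have h2 : Real.exp (-u) * Real.exp u = 1 := by rw [← Real.exp_add]; simp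
  nlinarith [Real.exp_pos u]

/-- The nonintegrable `1/|u|` singularity behind `exists_margin`. -/
theorem exp_div_neg_le_bose {u : ℝ} (hu : u < 0) : Real.exp u / -u ≤ bose u := by
  refine div_le_div_of_nonneg_left (Real.exp_pos u).le (one_sub_exp_pos hu) ?_
  linarith [Real.add_one_le_exp u]

theorem continuousOn_bose : ContinuousOn bose (Iio 0) := by
  refine Real.continuous_exp.continuousOn.div (by fun_prop) fun u hu => ?_
  exact (one_sub_exp_pos hu).ne'

/-- Tangent inequality for the convex function `-log (1 - exp u)`, of derivative `bose`. -/
theorem neg_log_one_sub_exp_ge {u v : ℝ} (hu : u < 0) (hv : v < 0) :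
    -Real.log (1 - Real.exp u) + bose u * (v - u) ≤ -Real.log (1 - Real.exp v) := by
  have pu := one_sub_exp_pos hu
  have pv := one_sub_exp_pos hv
  have h1 := Real.log_le_sub_one_of_pos (div_pos pv pu)
  rw [Real.log_div pv.ne' pu.ne'] at h1
  have h2 : (1 - Real.exp v) / (1 - Real.exp u) - 1 = bose u * (1 - Real.exp (v - u)) := by
    rw [bose, Real.exp_sub]
    have := Real.exp_pos u
    field_simp; ring
  have h3 := Real.add_one_le_exp (v - u)
  have h4 := bose_pos hu
  nlinarith

/-- `bose`, truncated so as to be continuous and bounded. -/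
noncomputable def boseTrunc (t u : ℝ) : ℝ := bose (min u (-t))

theorem continuous_boseTrunc {t : ℝ} (ht : 0 < t) : Continuous (boseTrunc t) :=
  continuousOn_bose.comp_continuous (by fun_prop) fun u =>
    (min_le_right u (-t)).trans_lt (by linarith)

theorem boseTrunc_of_le {t u : ℝ} (h : u ≤ -t) : boseTrunc t u = bose u := by
  rw [boseTrunc, min_eq_left h]

theorem boseTrunc_pos {t : ℝ} (ht : 0 < t) (u : ℝ) : 0 < boseTrunc t u :=
  bose_pos ((min_le_right u (-t)).trans_lt (by linarith))

/-! ### Uniform bounds for polynomials -/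

variable {k : ℕ}

theorem abs_polyVal_sub_le (a : Fin (k + 1) → ℝ) {y z : ℝ} (hy : y ∈ Icc (0 : ℝ) 1)
    (hz : z ∈ Icc (0 : ℝ) 1) :
    |polyVal a y - polyVal a z| ≤ ‖a‖ * ((k : ℝ) + 1) ^ 2 * |y - z| := by
  have h : polyVal a y - polyVal a z = ∑ i : Fin (k + 1), a i * (y ^ (i : ℕ) - z ^ (i : ℕ)) := by
    simp [polyVal, mul_sub]
  have h2 : ∀ i ∈ (Finset.univ : Finset (Fin (k + 1))),
      |a i * (y ^ (i : ℕ) - z ^ (i : ℕ))| ≤ ‖a‖ * ((k : ℝ) + 1) * |y - z| := by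
    intro i _
    rw [abs_mul]
    have h3 : |a i| ≤ ‖a‖ := norm_le_pi_norm a i
    have h4 : |y ^ (i : ℕ) - z ^ (i : ℕ)| ≤ |y - z| * ((k : ℝ) + 1) := by
      refine (abs_pow_sub_pow_le y z i).trans ?_
      have h5 : max |y| |z| ^ ((i : ℕ) - 1) ≤ 1 := by
        refine pow_le_one₀ (le_max_of_le_left (abs_nonneg y)) (max_le ?_ ?_)
        · rw [abs_of_nonneg hy.1]; exact hy.2
        · rw [abs_of_nonneg hz.1]; exact hz.2
      have h6 : ((i : ℕ) : ℝ) ≤ (k : ℝ) + 1 := by exact_mod_cast i.2.le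
      calc _ ≤ |y - z| * ((i : ℕ) : ℝ) * 1 := by gcongr
        _ ≤ _ := by rw [mul_one]; gcongr
    calc _ ≤ ‖a‖ * (|y - z| * ((k : ℝ) + 1)) := by gcongr
      _ = _ := by ring
  rw [h]
  refine (Finset.abs_sum_le_sum_abs _ _).trans ((Finset.sum_le_sum h2).trans ?_)
  simp only [Finset.sum_const, Finset.card_univ, Fintype.card_fin, nsmul_eq_mul]
  push_cast
  apply le_of_eq; ring

theorem abs_polyVal_le (a : Fin (k + 1) → ℝ) {y : ℝ} (hy : y ∈ Icc (0 : ℝ) 1) :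
    |polyVal a y| ≤ ((k : ℝ) + 1) * ‖a‖ := by
  have h2 : ∀ i ∈ (Finset.univ : Finset (Fin (k + 1))), |a i * y ^ (i : ℕ)| ≤ ‖a‖ := by
    intro i _
    rw [abs_mul, abs_pow, abs_of_nonneg hy.1]
    calc _ ≤ ‖a‖ * 1 := by
          gcongr
          · exact pow_nonneg hy.1 _
          · exact norm_le_pi_norm a i
          · exact pow_le_one₀ hy.1 hy.2
      _ = _ := mul_one _
  refine (Finset.abs_sum_le_sum_abs _ _).trans ((Finset.sum_le_sum h2).trans ?_)
  simp

theorem continuousOn_bose_polyVal {a : Fin (k + 1) → ℝ} {s : Set ℝ}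
    (h : ∀ y ∈ s, polyVal a y < 0) : ContinuousOn (fun y => bose (polyVal a y)) s :=
  continuousOn_bose.comp (continuous_polyVal_right a).continuousOn h

theorem intervalIntegrable_bose {a : Fin (k + 1) → ℝ} {c : ℝ} (hc : 0 ≤ c)
    (h : ∀ y ∈ Icc 0 c, polyVal a y < 0) {φ : ℝ → ℝ} (hφ : Continuous φ) :
    IntervalIntegrable (fun y => φ y * bose (polyVal a y)) volume 0 c := by
  refine ContinuousOn.intervalIntegrable ?_
  rw [uIcc_of_le hc]
  exact hφ.continuousOn.mul (continuousOn_bose_polyVal h)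

theorem intervalIntegrable_bose' {a : Fin (k + 1) → ℝ} {c : ℝ} (hc : 0 ≤ c)
    (h : ∀ y ∈ Icc 0 c, polyVal a y < 0) :
    IntervalIntegrable (fun y => bose (polyVal a y)) volume 0 c := by
  simpa using intervalIntegrable_bose hc h (continuous_const (y := (1 : ℝ)))

theorem integral_inv_right {K t z h : ℝ} (hK : 0 < K) (ht : 0 < t) (hh : 0 ≤ h) :
    ∫ y in z..z + h, (K * |y - z| + t)⁻¹ = Real.log ((K * h + t) / t) / K := by
  have e : ∀ y ∈ uIcc z (z + h),
      HasDerivAt (fun y => Real.log (K * (y - z) + t) / K) ((K * |y - z| + t)⁻¹) y := by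
    intro y hy
    rw [uIcc_of_le (by linarith)] at hy
    have hy0 : 0 ≤ y - z := by linarith [hy.1]
    have hp : 0 < K * (y - z) + t := by positivity
    have h1 := ((((hasDerivAt_id y).sub_const z).const_mul K).add_const t).log hp.ne'
    convert! h1.div_const K using 1
    rw [abs_of_nonneg hy0]
    simp only [id]
    field_simp
  rw [intervalIntegral.integral_eq_sub_of_hasDerivAt e, Real.log_div (by positivity) ht.ne']
  · simp [sub_div]
  · exact (Continuous.inv₀ (by fun_prop) fun y => by positivity).intervalIntegrable _ _

theorem integral_inv_left {K t z h : ℝ} (hK : 0 < K) (ht : 0 < t) (hh : 0 ≤ h) :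
    ∫ y in z - h..z, (K * |y - z| + t)⁻¹ = Real.log ((K * h + t) / t) / K := by
  rw [← integral_inv_right (z := -z) hK ht hh]
  have : ∀ y, |y - z| = |-y - -z| := fun y => by rw [abs_sub_comm]; congr 1; ring
  simp only [this]
  rw [intervalIntegral.integral_comp_neg (fun y => (K * |y - -z| + t)⁻¹)]
  congr 1; ring

/-- If the integral of `bose ∘ p` is bounded, then `p` stays away from `0`. -/
theorem exists_margin (k : ℕ) (R m : ℝ) {c₀ : ℝ} (hc₀ : 0 < c₀) :
    ∃ t > 0, ∀ a : Fin (k + 1) → ℝ, ‖a‖ ≤ R → ∀ c ∈ Icc c₀ 1,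
      (∀ y ∈ Icc 0 c, polyVal a y < 0) → ∫ y in (0 : ℝ)..c, bose (polyVal a y) ≤ m →
      ∀ y ∈ Icc 0 c, polyVal a y ≤ -t := by
  -- `K` bounds the Lipschitz constant of `p` and `M` its absolute value. If `p z > -t`, then `-p y
  -- ≤ K|y - z| + t`, so `bose (p y) ≥ e^{-M}/(K|y - z| + t)`. At least one side of `z` in `[0, c]`
  -- has length `h = c₀/2`, and there the integral is at least `e^{-M} log(1 + K h/t)/K`; `t` is
  -- chosen to make `K h/t = e^{m'}`, so that this exceeds `m`.
  set K : ℝ := |R| * ((k : ℝ) + 1) ^ 2 + 1 with hK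
  set M : ℝ := ((k : ℝ) + 1) * |R| with hM
  have hKp : 0 < K := by positivity
  set h : ℝ := c₀ / 2 with hh
  have hhp : 0 < h := by positivity
  set m' : ℝ := m * K * Real.exp M with hm'
  set t : ℝ := K * h * Real.exp (-m') with ht
  have htp : 0 < t := by positivity
  have hlog : m < Real.exp (-M) * (Real.log ((K * h + t) / t) / K) := by
    have h1 : (K * h + t) / t = Real.exp m' + 1 := by
      rw [ht, Real.exp_neg]; field_simp
    have h2 : m' < Real.log ((K * h + t) / t) := by
      rw [h1, Real.lt_log_iff_exp_lt (by positivity)]; linarith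
    calc m = Real.exp (-M) * (m' / K) := by
          rw [hm', Real.exp_neg]; field_simp
      _ < _ := by gcongr
  refine ⟨t, htp, fun a ha c hc hneg hint z hz => ?_⟩
  by_contra! hzt
  have hc0 : 0 ≤ c := hc₀.le.trans hc.1
  have haR : ‖a‖ ≤ |R| := ha.trans (le_abs_self R)
  have hI : ∀ y ∈ Icc 0 c, y ∈ Icc (0 : ℝ) 1 := fun y hy => ⟨hy.1, hy.2.trans hc.2⟩
  have hlow : ∀ y ∈ Icc 0 c, Real.exp (-M) * (K * |y - z| + t)⁻¹ ≤ bose (polyVal a y) := by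
    intro y hy
    refine le_trans ?_ (exp_div_neg_le_bose (hneg y hy))
    have h1 := abs_le.1 (abs_polyVal_sub_le a (hI y hy) (hI z hz))
    have h2 := abs_le.1 (abs_polyVal_le a (hI y hy))
    have h3 : ‖a‖ * ((k : ℝ) + 1) ^ 2 * |y - z| ≤ K * |y - z| := by
      gcongr
      rw [hK]
      have : ‖a‖ * ((k : ℝ) + 1) ^ 2 ≤ |R| * ((k : ℝ) + 1) ^ 2 := by gcongr
      linarith
    have h4 : ((k : ℝ) + 1) * ‖a‖ ≤ M := by rw [hM]; gcongr
    rw [div_eq_mul_inv]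
    have h5 : 0 < -polyVal a y := by linarith [hneg y hy]
    gcongr <;> linarith [h1.1, h2.1]
  have hcont : Continuous fun y : ℝ => Real.exp (-M) * (K * |y - z| + t)⁻¹ :=
    continuous_const.mul (Continuous.inv₀ (by fun_prop) fun y => by positivity)
  have hle : ∫ y in (0 : ℝ)..c, Real.exp (-M) * (K * |y - z| + t)⁻¹ ≤ m :=
    (intervalIntegral.integral_mono_on hc0 (hcont.intervalIntegrable _ _)
      (intervalIntegrable_bose' hc0 hneg) hlow).trans hint
  have hsub : ∀ l r : ℝ, 0 ≤ l → l ≤ r → r ≤ c →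
      ∫ y in l..r, Real.exp (-M) * (K * |y - z| + t)⁻¹ ≤ m := fun l r hl hlr hr =>
    (intervalIntegral.integral_mono_interval hl hlr hr
      (Eventually.of_forall fun y => by positivity) (hcont.intervalIntegrable _ _)).trans hle
  have hch : 2 * h ≤ c := by rw [hh]; linarith [hc.1]
  rcases le_total z h with hzh | hzh
  · have := hsub z (z + h) hz.1 (by linarith) (by linarith)
    rw [intervalIntegral.integral_const_mul, integral_inv_right hKp htp hhp.le] at this
    linarith
  · have := hsub (z - h) z (by linarith) (by linarith) hz.2
    rw [intervalIntegral.integral_const_mul, integral_inv_left hKp htp hhp.le] at this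
    linarith

theorem continuous_integral_boseTrunc {t : ℝ} (ht : 0 < t) (n : ℕ) :
    Continuous fun q : (Fin (k + 1) → ℝ) × ℝ =>
      ∫ y in (0 : ℝ)..q.2, y ^ n * boseTrunc t (polyVal q.1 y) := by
  refine intervalIntegral.continuous_parametric_intervalIntegral_of_continuous
    (f := fun (q : (Fin (k + 1) → ℝ) × ℝ) y => y ^ n * boseTrunc t (polyVal q.1 y)) ?_
    continuous_snd
  have h := continuous_polyVal (k := k).comp
    ((continuous_fst.comp continuous_fst).prodMk (continuous_snd (X := (Fin (k + 1) → ℝ) × ℝ)))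
  exact (continuous_snd.pow n).mul ((continuous_boseTrunc ht).comp h)

theorem integral_bose_eq_trunc {a : Fin (k + 1) → ℝ} {c t : ℝ} (hc : 0 ≤ c)
    (h : ∀ y ∈ Icc 0 c, polyVal a y ≤ -t) (n : ℕ) :
    ∫ y in (0 : ℝ)..c, y ^ n * bose (polyVal a y) =
      ∫ y in (0 : ℝ)..c, y ^ n * boseTrunc t (polyVal a y) := by
  refine intervalIntegral.integral_congr fun y hy => ?_
  rw [uIcc_of_le hc] at hy
  simp only [boseTrunc_of_le (h y hy)]

/-- Convergence of the moments of `bose ∘ p` when `p` stays uniformly negative. -/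
theorem tendsto_integral_bose {ι : Type*} {l : Filter ι} [l.NeBot] {a : ι → Fin (k + 1) → ℝ}
    {c : ι → ℝ} {a₀ : Fin (k + 1) → ℝ} {c₀ t : ℝ} (ht : 0 < t) (ha : Tendsto a l (𝓝 a₀))
    (hc : Tendsto c l (𝓝 c₀))
    (h : ∀ᶠ j in l, 0 ≤ c j ∧ ∀ y ∈ Icc 0 (c j), polyVal (a j) y ≤ -t) :
    (∀ y ∈ Icc 0 c₀, polyVal a₀ y ≤ -t) ∧ ∀ n : ℕ,
      Tendsto (fun j => ∫ y in (0 : ℝ)..c j, y ^ n * bose (polyVal (a j) y)) l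
        (𝓝 (∫ y in (0 : ℝ)..c₀, y ^ n * bose (polyVal a₀ y))) := by
  have h1 : ∀ y ∈ Icc 0 c₀, polyVal a₀ y ≤ -t := by
    intro y hy
    -- The point `y` need not lie in `[0, c j]`; its truncation does, and still converges to `y`.
    have h2 : Tendsto (fun j => min (c j) y) l (𝓝 y) := by
      simpa [min_eq_right hy.2] using hc.min (tendsto_const_nhds (x := y))
    have h3 : Tendsto (fun j => polyVal (a j) (min (c j) y)) l (𝓝 (polyVal a₀ y)) :=
      (continuous_polyVal.tendsto (a₀, y)).comp (ha.prodMk_nhds h2)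
    refine le_of_tendsto h3 ?_
    filter_upwards [h] with j hj
    exact hj.2 _ ⟨le_min hj.1 hy.1, min_le_left _ _⟩
  refine ⟨h1, fun n => ?_⟩
  have hc₀ : 0 ≤ c₀ := ge_of_tendsto hc (h.mono fun j hj => hj.1)
  rw [integral_bose_eq_trunc hc₀ h1]
  refine (((continuous_integral_boseTrunc ht n).tendsto (a₀, c₀)).comp
    (ha.prodMk_nhds hc)).congr' ?_
  filter_upwards [h] with j hj
  exact (integral_bose_eq_trunc hj.1 hj.2 n).symm

/-! ### The endpoint attached to a polynomial -/

/-- `c` is the point where the solution of `H' = 1 / (1 - exp p)`, `H 0 = 0` takes the value `1`. -/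
structure IsEndpoint (a : Fin (k + 1) → ℝ) (c : ℝ) : Prop where
  nonneg : 0 ≤ c
  neg : ∀ y ∈ Icc 0 c, polyVal a y < 0
  integral_eq : c + ∫ y in (0 : ℝ)..c, bose (polyVal a y) = 1

namespace IsEndpoint

variable {a : Fin (k + 1) → ℝ} {c : ℝ}

theorem integral_bose (h : IsEndpoint a c) : ∫ y in (0 : ℝ)..c, bose (polyVal a y) = 1 - c := by
  linarith [h.integral_eq]

theorem integral_nonneg (h : IsEndpoint a c) : 0 ≤ ∫ y in (0 : ℝ)..c, bose (polyVal a y) :=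
  intervalIntegral.integral_nonneg h.nonneg fun y hy => (bose_pos (h.neg y hy)).le

theorem le_one (h : IsEndpoint a c) : c ≤ 1 := by
  linarith [h.integral_eq, h.integral_nonneg]

theorem pos (h : IsEndpoint a c) : 0 < c := by
  refine lt_of_le_of_ne h.nonneg fun h0 => ?_
  have := h.integral_eq
  rw [← h0] at this
  simp at this

theorem lt_one (h : IsEndpoint a c) : c < 1 := by
  have : 0 < ∫ y in (0 : ℝ)..c, bose (polyVal a y) := by
    refine intervalIntegral.intervalIntegral_pos_of_pos_on
      (intervalIntegrable_bose' h.nonneg h.neg) (fun y hy => ?_) h.pos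
    exact bose_pos (h.neg y ⟨hy.1.le, hy.2.le⟩)
  linarith [h.integral_eq]

theorem unique {c' : ℝ} (h : IsEndpoint a c) (h' : IsEndpoint a c') : c = c' := by
  wlog hcc : c ≤ c' generalizing c c'
  · exact (this h' h (le_of_not_ge hcc)).symm
  have h1 : ∫ y in (0 : ℝ)..c, bose (polyVal a y) ≤ ∫ y in (0 : ℝ)..c', bose (polyVal a y) := by
    refine intervalIntegral.integral_mono_interval le_rfl h.nonneg hcc ?_
      (intervalIntegrable_bose' h'.nonneg h'.neg)
    filter_upwards [ae_restrict_mem measurableSet_Ioc] with y hy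
    exact (bose_pos (h'.neg y ⟨hy.1.le, hy.2⟩)).le
  linarith [h.integral_eq, h'.integral_eq]

end IsEndpoint

/-- `y + ∫_0^y bose ∘ p` starts at `0` and must reach `1`: by `y = 1` if `p` stays negative on `[0,
1]`, and otherwise before the first zero of `p`, where the integral blows up. -/
theorem exists_isEndpoint {a : Fin (k + 1) → ℝ} (ha : a 0 < 0) : ∃ c, IsEndpoint a c := by
  have key : ∃ z ∈ Ioc (0 : ℝ) 1, (∀ y ∈ Icc 0 z, polyVal a y < 0) ∧
      1 ≤ z + ∫ y in (0 : ℝ)..z, bose (polyVal a y) := by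
    by_cases hneg : ∀ y ∈ Icc (0 : ℝ) 1, polyVal a y < 0
    · refine ⟨1, by simp, hneg, ?_⟩
      have : 0 ≤ ∫ y in (0 : ℝ)..1, bose (polyVal a y) :=
        intervalIntegral.integral_nonneg zero_le_one fun y hy => (bose_pos (hneg y hy)).le
      linarith
    · push Not at hneg
      set Z : Set ℝ := {y ∈ Icc (0 : ℝ) 1 | 0 ≤ polyVal a y} with hZ
      have hZc : IsCompact Z := isCompact_Icc.inter_right
        (isClosed_le continuous_const (continuous_polyVal_right a))
      have hzZ : sInf Z ∈ Z := hZc.sInf_mem hneg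
      set z := sInf Z with hz
      have hlt : ∀ y, 0 ≤ y → y < z → polyVal a y < 0 := by
        intro y hy hyz
        by_contra! hy2
        exact absurd (csInf_le hZc.bddBelow ⟨⟨hy, hyz.le.trans hzZ.1.2⟩, hy2⟩) (not_le.2 hyz)
      have hz0 : 0 < z := by
        refine lt_of_le_of_ne hzZ.1.1 fun h0 => ?_
        have := hzZ.2
        rw [← h0, polyVal_zero_right] at this
        linarith
      -- If the value `1` were not reached before `z`, the integrals would be bounded by `1`, and
      -- the margin would give `p ≤ -t` just left of `z`, hence at `z`, where `p` is nonnegative.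
      obtain ⟨t, ht, hmar⟩ := exists_margin k ‖a‖ 1 (half_pos hz0)
      by_contra! hcon
      have h1 : ∀ᶠ y in 𝓝[<] z, polyVal a y ≤ -t := by
        filter_upwards [Ioo_mem_nhdsLT (half_lt_self hz0)] with y hy
        have hy0 : 0 < y := (half_pos hz0).trans hy.1
        have hyn : ∀ x ∈ Icc 0 y, polyVal a x < 0 := fun x hx =>
          hlt x hx.1 (hx.2.trans_lt hy.2)
        have hy1 : y ≤ 1 := hy.2.le.trans hzZ.1.2
        refine hmar a le_rfl y ⟨hy.1.le, hy1⟩ hyn ?_ y ⟨hy0.le, le_rfl⟩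
        linarith [hcon y ⟨hy0, hy1⟩ hyn]
      have h2 : polyVal a z ≤ -t := le_of_tendsto
        ((continuous_polyVal_right a).continuousAt.mono_left nhdsWithin_le_nhds) h1
      linarith [hzZ.2]
  obtain ⟨z, hz, hneg, hge⟩ := key
  have hcont : ContinuousOn (fun x => x + ∫ y in (0 : ℝ)..x, bose (polyVal a y)) (Icc 0 z) := by
    refine continuousOn_id.add ?_
    have := intervalIntegral.continuousOn_primitive_interval' (μ := volume)
      (intervalIntegrable_bose' hz.1.le hneg) (left_mem_uIcc)
    rwa [uIcc_of_le hz.1.le] at this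
  have h01 : (1 : ℝ) ∈ Icc (0 + ∫ y in (0 : ℝ)..0, bose (polyVal a y))
      (z + ∫ y in (0 : ℝ)..z, bose (polyVal a y)) := ⟨by simp, hge⟩
  obtain ⟨c, hc, hc1⟩ := intermediate_value_Icc hz.1.le hcont h01
  exact ⟨c, hc.1, fun y hy => hneg y ⟨hy.1, hy.2.trans hc.2⟩, hc1⟩

end Endpoint

section Shape

open Filter Topology

variable {k : ℕ} {f : ℝ → ℝ} {a : Fin (k + 1) → ℝ} {c t : ℝ}

/-! ### The inverse distribution function attached to a polynomial -/

/-- The primitive of `1 + bose ∘ p`, with `bose` truncated. -/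
noncomputable def invProfile (a : Fin (k + 1) → ℝ) (t y : ℝ) : ℝ :=
  ∫ u in (0 : ℝ)..y, (1 + boseTrunc t (polyVal a u))

theorem continuous_slope (a : Fin (k + 1) → ℝ) (ht : 0 < t) :
    Continuous fun u => 1 + boseTrunc t (polyVal a u) :=
  continuous_const.add ((continuous_boseTrunc ht).comp (continuous_polyVal_right a))

theorem hasDerivAt_invProfile (a : Fin (k + 1) → ℝ) (ht : 0 < t) (y : ℝ) :
    HasDerivAt (invProfile a t) (1 + boseTrunc t (polyVal a y)) y :=
  ((continuous_slope a ht).integral_hasStrictDerivAt 0 y).hasDerivAt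

theorem invProfile_zero (a : Fin (k + 1) → ℝ) (t : ℝ) : invProfile a t 0 = 0 := by
  simp [invProfile]

theorem sub_le_invProfile_sub (a : Fin (k + 1) → ℝ) (ht : 0 < t) {x y : ℝ} (hxy : x ≤ y) :
    y - x ≤ invProfile a t y - invProfile a t x := by
  have hi := fun u v => (continuous_slope a ht).intervalIntegrable (μ := volume) u v
  rw [invProfile, invProfile, intervalIntegral.integral_interval_sub_left (hi _ _) (hi _ _)]
  have := intervalIntegral.integral_mono_on hxy (intervalIntegrable_const (c := (1 : ℝ)))
    (hi x y) fun u _ => by linarith [boseTrunc_pos ht (polyVal a u)]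
  simpa using this

theorem strictMono_invProfile (a : Fin (k + 1) → ℝ) (ht : 0 < t) :
    StrictMono (invProfile a t) := fun x y hxy => by
  linarith [sub_le_invProfile_sub a ht hxy.le]

theorem surjective_invProfile (a : Fin (k + 1) → ℝ) (ht : 0 < t) :
    Function.Surjective (invProfile a t) := by
  have hc : Continuous (invProfile a t) :=
    continuous_iff_continuousAt.2 fun y => (hasDerivAt_invProfile a ht y).continuousAt
  refine hc.surjective (tendsto_atTop_mono' _ ?_ tendsto_id) (tendsto_atBot_mono' _ ?_ tendsto_id)
  · filter_upwards [eventually_ge_atTop 0] with y hy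
    simpa [invProfile_zero] using sub_le_invProfile_sub a ht hy
  · filter_upwards [eventually_le_atBot 0] with y hy
    have := sub_le_invProfile_sub a ht hy
    simp only [invProfile_zero] at this
    simp only [id]; linarith

theorem one_add_boseTrunc {u : ℝ} (ht : 0 < t) (h : u ≤ -t) :
    1 + boseTrunc t u = 1 / (1 - Real.exp u) := by
  rw [boseTrunc_of_le h, one_add_bose (by linarith)]

theorem invProfile_eq (hc : 0 ≤ c) (ht : 0 < t) (h : ∀ y ∈ Icc 0 c, polyVal a y ≤ -t) :
    invProfile a t c = c + ∫ y in (0 : ℝ)..c, bose (polyVal a y) := by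
  have h1 := integral_bose_eq_trunc hc h 0
  simp only [pow_zero, one_mul] at h1
  rw [invProfile, intervalIntegral.integral_add, h1]
  · simp
  · exact intervalIntegrable_const
  · exact ((continuous_boseTrunc ht).comp (continuous_polyVal_right a)).intervalIntegrable _ _

theorem IsEndpoint.exists_le_neg (h : IsEndpoint a c) :
    ∃ t > 0, ∀ y ∈ Icc 0 c, polyVal a y ≤ -t := by
  obtain ⟨z, hz, hmax⟩ := isCompact_Icc.exists_isMaxOn (nonempty_Icc.2 h.nonneg)
    (continuous_polyVal_right a).continuousOn
  exact ⟨-polyVal a z, by linarith [h.neg z hz], fun y hy => by simpa using hmax hy⟩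

/-- The truncated profile is an increasing bijection of the whole line; its inverse is the
distribution function and the derivative of that inverse is the density. -/
theorem IsEndpoint.exists_isSublebesgue (h : IsEndpoint a c) :
    ∃ f, IsSublebesgue f ∧ distrib f 1 = c ∧
      ∀ x ∈ Icc (0 : ℝ) 1, f x = 1 - Real.exp (polyVal a (distrib f x)) := by
  obtain ⟨t, ht, hneg⟩ := h.exists_le_neg
  let e := (strictMono_invProfile a ht).orderIsoOfSurjective _ (surjective_invProfile a ht)
  have he : ∀ x, invProfile a t (e.symm x) = x := fun x => e.apply_symm_apply x
  have he' : ∀ y, e.symm (invProfile a t y) = y := fun y => e.symm_apply_apply y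
  have hcont : Continuous e.symm := e.symm.continuous
  have hd : ∀ x, HasDerivAt e.symm (1 + boseTrunc t (polyVal a (e.symm x)))⁻¹ x := fun x =>
    HasDerivAt.of_local_left_inverse hcont.continuousAt (hasDerivAt_invProfile a ht _)
      (by linarith [boseTrunc_pos ht (polyVal a (e.symm x))]) (Eventually.of_forall he)
  have hfc : Continuous fun x => (1 + boseTrunc t (polyVal a (e.symm x)))⁻¹ :=
    ((continuous_slope a ht).comp hcont).inv₀ fun x => by
      have := boseTrunc_pos ht (polyVal a (e.symm x))
      simp only [Function.comp]; linarith
  have h0 : e.symm 0 = 0 := by simpa [invProfile_zero] using he' 0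
  have h1 : e.symm 1 = c := by
    rw [← he' c, invProfile_eq h.nonneg ht hneg, h.integral_eq]
  have hF : ∀ x, distrib (fun x => (1 + boseTrunc t (polyVal a (e.symm x)))⁻¹) x = e.symm x := by
    intro x
    rw [distrib, intervalIntegral.integral_eq_sub_of_hasDerivAt (fun y _ => hd y)
      (hfc.intervalIntegrable _ _), h0, sub_zero]
  refine ⟨fun x => (1 + boseTrunc t (polyVal a (e.symm x)))⁻¹,
    ⟨hfc.measurable, fun x _ => ?_⟩, by rw [hF, h1], fun x hx => ?_⟩
  · have := boseTrunc_pos ht (polyVal a (e.symm x))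
    exact ⟨by positivity, inv_le_one_of_one_le₀ (by linarith)⟩
  · rw [hF]
    have hmem : e.symm x ∈ Icc 0 c :=
      ⟨h0 ▸ e.symm.monotone hx.1, h1 ▸ e.symm.monotone hx.2⟩
    simp only
    rw [one_add_boseTrunc ht (hneg _ hmem), one_div, inv_inv]

/-- A sublebesgue measure with `f = 1 - exp (p (F x))` has the prescribed inverse. -/
theorem IsSublebesgue.invProfile_distrib (hf : IsSublebesgue f) (ht : 0 < t)
    (hneg : ∀ y ∈ Icc 0 (distrib f 1), polyVal a y ≤ -t)
    (h : SameMeasure f fun x => 1 - Real.exp (polyVal a (distrib f x))) :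
    ∀ x ∈ Icc (0 : ℝ) 1, invProfile a t (distrib f x) = x := by
  set v : ℝ → ℝ := fun x => 1 - Real.exp (polyVal a (distrib f x)) with hv
  have hvc : ContinuousOn v (Icc 0 1) := by
    have := (continuous_polyVal_right a).comp_continuousOn hf.continuousOn_distrib
    exact continuousOn_const.sub (Real.continuous_exp.comp_continuousOn this)
  -- Replacing `f` by the continuous `v` gives `distrib f` a right derivative everywhere on `[0,
  -- 1)`, so that `invProfile (distrib f x) - x`, with right derivative zero, is constant.
  have hFv : ∀ x ∈ Icc (0 : ℝ) 1, distrib f x = ∫ s in (0 : ℝ)..x, v s := by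
    intro x hx
    refine intervalIntegral.integral_congr_ae ?_
    have h' := (ae_restrict_iff' measurableSet_Icc).1 h
    filter_upwards [h'] with s hs hsx
    rw [uIoc_of_le hx.1] at hsx
    exact hs ⟨hsx.1.le, hsx.2.trans hx.2⟩
  have hd : ∀ x ∈ Ico (0 : ℝ) 1, HasDerivWithinAt (distrib f) (v x) (Ici x) x := by
    intro x hx
    have hi : IntervalIntegrable v volume 0 x :=
      (hvc.mono (uIcc_subset_Icc (by simp) ⟨hx.1, hx.2.le⟩)).intervalIntegrable
    have hxm : Icc (0 : ℝ) 1 ∈ 𝓝[>] x :=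
      mem_of_superset (Ioo_mem_nhdsGT hx.2) fun y hy => ⟨hx.1.trans hy.1.le, hy.2.le⟩
    have h1 := intervalIntegral.integral_hasDerivWithinAt_right hi (s := Ici x) (t := Ioi x)
      (⟨Icc 0 1, hxm, hvc.aestronglyMeasurable measurableSet_Icc⟩)
      ((hvc x ⟨hx.1, hx.2.le⟩).mono_of_mem_nhdsWithin hxm)
    refine h1.congr_of_eventuallyEq ?_ (hFv x ⟨hx.1, hx.2.le⟩)
    filter_upwards [Ico_mem_nhdsGE hx.2] with y hy
    exact hFv y ⟨hx.1.trans hy.1, hy.2.le⟩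
  have hconst := constant_of_has_deriv_right_zero (a := 0) (b := 1)
    (f := fun x => invProfile a t (distrib f x) - x) ?_ ?_
  · intro x hx
    have := hconst x hx
    simp only [distrib_zero, invProfile_zero, sub_zero] at this
    linarith
  · refine ContinuousOn.sub ?_ continuousOn_id
    have hc : Continuous (invProfile a t) :=
      continuous_iff_continuousAt.2 fun y => (hasDerivAt_invProfile a ht y).continuousAt
    exact hc.comp_continuousOn hf.continuousOn_distrib
  · intro x hx
    have hm := hf.distrib_mem ⟨hx.1, hx.2.le⟩
    have h1 := ((hasDerivAt_invProfile a ht (distrib f x)).comp_hasDerivWithinAt x (hd x hx)).sub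
      (hasDerivWithinAt_id x (Ici x))
    convert! h1 using 1
    rw [one_add_boseTrunc ht (hneg _ hm), hv]
    have := (one_sub_exp_pos ((hneg _ hm).trans_lt (by linarith))).ne'
    field_simp
    simp

theorem SameMeasure.of_profile {g : ℝ → ℝ} (hf : IsSublebesgue f) (hg : IsSublebesgue g)
    (h : IsEndpoint a c) (hfc : distrib f 1 = c) (hgc : distrib g 1 = c)
    (hfa : SameMeasure f fun x => 1 - Real.exp (polyVal a (distrib f x)))
    (hga : SameMeasure g fun x => 1 - Real.exp (polyVal a (distrib g x))) :
    SameMeasure f g := by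
  obtain ⟨t, ht, hneg⟩ := h.exists_le_neg
  refine sameMeasure_of_distrib_eq hf hg fun x hx => (strictMono_invProfile a ht).injective ?_
  rw [hf.invProfile_distrib ht (by rwa [hfc]) hfa x hx,
    hg.invProfile_distrib ht (by rwa [hgc]) hga x hx]

theorem IsEndpoint.hasInverseSlope {p : NegPoly k} (h : IsEndpoint p.1 c)
    (hf : IsSublebesgue f) (hfc : distrib f 1 = c)
    (hfa : SameMeasure f fun x => 1 - Real.exp (polyVal p.1 (distrib f x))) :
    HasInverseSlope f p := by
  obtain ⟨t, ht, hneg⟩ := h.exists_le_neg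
  have hinv := hf.invProfile_distrib ht (by rwa [hfc]) hfa
  have key : ∀ y ∈ Icc 0 c, invDistrib f y = invProfile p.1 t y := by
    intro y hy
    obtain ⟨x, hx, rfl⟩ := intermediate_value_Icc zero_le_one hf.continuousOn_distrib
      (show y ∈ Icc (distrib f 0) (distrib f 1) by rwa [distrib_zero, hfc])
    rw [hinv x hx, invDistrib]
    refine IsLeast.csInf_eq ⟨⟨hx, le_rfl⟩, fun z hz => ?_⟩
    rw [← hinv x hx, ← hinv z hz.1]
    exact (strictMono_invProfile p.1 ht).monotone hz.2
  refine ⟨?_, fun y hy => ?_⟩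
  · rw [hfc, key c ⟨h.nonneg, le_rfl⟩, invProfile_eq h.nonneg ht hneg, h.integral_eq]
  · rw [hfc] at hy ⊢
    refine ⟨h.neg y hy, ?_⟩
    have h1 := (hasDerivAt_invProfile p.1 ht y).hasDerivWithinAt (s := Icc 0 c)
    rw [one_add_boseTrunc ht (hneg y hy)] at h1
    exact h1.congr key (key y hy)

/-! ### Recovering the endpoint and the densities from a shape -/

theorem IsSublebesgue.invDistrib_mem (hf : IsSublebesgue f) {y : ℝ}
    (hy : y ∈ Icc 0 (distrib f 1)) :
    invDistrib f y ∈ Icc (0 : ℝ) 1 ∧ distrib f (invDistrib f y) = y := by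
  set S := {x | x ∈ Icc (0 : ℝ) 1 ∧ y ≤ distrib f x} with hS
  have hcl : IsClosed S := by
    exact hf.continuousOn_distrib.preimage_isClosed_of_isClosed isClosed_Icc isClosed_Ici
  have hbdd : BddBelow S := ⟨0, fun x hx => hx.1.1⟩
  have hmem : invDistrib f y ∈ S := hcl.csInf_mem ⟨1, by simp, hy.2⟩ hbdd
  refine ⟨hmem.1, ?_⟩
  obtain ⟨x, hx, hxy⟩ := intermediate_value_Icc hmem.1.1
    (hf.continuousOn_distrib.mono (Icc_subset_Icc_right hmem.1.2))
    (show y ∈ Icc (distrib f 0) (distrib f (invDistrib f y)) by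
      rw [distrib_zero]; exact ⟨hy.1, hmem.2⟩)
  have h1 : invDistrib f y ≤ x := csInf_le hbdd ⟨⟨hx.1, hx.2.trans hmem.1.2⟩, hxy.ge⟩
  rw [← le_antisymm hx.2 h1] at *
  exact hxy

theorem invDistrib_zero (f : ℝ → ℝ) : invDistrib f 0 = 0 :=
  IsLeast.csInf_eq ⟨⟨by simp, (distrib_zero f).ge⟩, fun _ hx => hx.1.1⟩

/-- Change of variables `x = H(y)`, using `F(H(y)) = y`; the condition `H(F(1)) = 1` ensures that
all of `[0, 1]` is covered. The case `n = 0` is the endpoint equation, the others give the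
densities. -/
theorem HasInverseSlope.integral_pow (hf : IsSublebesgue f) {p : NegPoly k}
    (h : HasInverseSlope f p) (n : ℕ) :
    ∫ y in (0 : ℝ)..distrib f 1, y ^ n * (1 + bose (polyVal p.1 y)) =
      ∫ x in (0 : ℝ)..1, distrib f x ^ n := by
  have hc := hf.distrib_nonneg (x := 1) (by simp)
  have hneg : ∀ y ∈ Icc 0 (distrib f 1), polyVal p.1 y < 0 := fun y hy => (h.2 y hy).1
  have hder : ∀ y ∈ Icc 0 (distrib f 1),
      HasDerivWithinAt (invDistrib f) (1 + bose (polyVal p.1 y)) (Icc 0 (distrib f 1)) y := by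
    intro y hy
    rw [one_add_bose (hneg y hy)]
    exact (h.2 y hy).2
  have h1 := intervalIntegral.integral_comp_mul_deriv'' (a := 0) (b := distrib f 1)
    (f := invDistrib f) (f' := fun y => 1 + bose (polyVal p.1 y))
    (g := fun x => distrib f x ^ n) ?_ ?_ ?_ ?_
  · rw [invDistrib_zero, h.1] at h1
    rw [← h1]
    refine intervalIntegral.integral_congr fun y hy => ?_
    rw [uIcc_of_le hc] at hy
    simp only [Function.comp, (hf.invDistrib_mem hy).2]
  · rw [uIcc_of_le hc]
    exact fun y hy => (hder y hy).continuousWithinAt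
  · rw [min_eq_left hc, max_eq_right hc]
    intro y hy
    exact ((hder y ⟨hy.1.le, hy.2.le⟩).hasDerivAt (Icc_mem_nhds hy.1 hy.2)).hasDerivWithinAt
  · rw [uIcc_of_le hc]
    exact continuousOn_const.add (continuousOn_bose_polyVal hneg)
  · rw [uIcc_of_le hc]
    refine (hf.continuousOn_distrib.pow n).mono ?_
    rintro _ ⟨y, hy, rfl⟩
    exact (hf.invDistrib_mem hy).1

theorem HasInverseSlope.isEndpoint (hf : IsSublebesgue f) {p : NegPoly k}
    (h : HasInverseSlope f p) : IsEndpoint p.1 (distrib f 1) := by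
  have hc := hf.distrib_nonneg (x := 1) (by simp)
  have hneg : ∀ y ∈ Icc 0 (distrib f 1), polyVal p.1 y < 0 := fun y hy => (h.2 y hy).1
  refine ⟨hc, hneg, ?_⟩
  have h0 := h.integral_pow hf 0
  simp only [pow_zero, one_mul] at h0
  rw [intervalIntegral.integral_add intervalIntegrable_const (intervalIntegrable_bose' hc hneg)]
    at h0
  simpa using h0

/-- The density vector of the shape given by a polynomial and its endpoint. -/
noncomputable def shapeDensities (a : Fin (k + 1) → ℝ) (c : ℝ) : Fin (k + 1) → ℝ := fun i =>
  ((i : ℕ) + 1) * ∫ y in (0 : ℝ)..c, y ^ (i : ℕ) * bose (polyVal a y)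

theorem HasInverseSlope.densities_eq (hf : IsSublebesgue f) {p : NegPoly k}
    (h : HasInverseSlope f p) : densities k f = shapeDensities p.1 (distrib f 1) := by
  ext i
  have he := h.isEndpoint hf
  have h0 := h.integral_pow hf (i : ℕ)
  simp only [mul_add, mul_one] at h0
  rw [intervalIntegral.integral_add ((continuous_pow _).intervalIntegrable _ _)
    (intervalIntegrable_bose he.nonneg he.neg (continuous_pow _)), _root_.integral_pow] at h0
  rw [hf.densities_eq_sub, shapeDensities, ← h0]
  field_simp
  simp

end Shape

section Dual

open Filter Topology

variable {k : ℕ}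

/-! ### Polynomials with given moments -/

/-- Vectors whose moment functional is positive on nonnegative polynomials. -/
def momentInterior (k : ℕ) : Set (Fin (k + 1) → ℝ) :=
  {δ | 0 < δ 0 ∧ δ 0 < 1 ∧ ∀ a : Fin (k + 1) → ℝ, a ≠ 0 →
    (∀ y ∈ Icc 0 (1 - δ 0), 0 ≤ polyVal a y) → 0 < momentFun δ a}

theorem isClosed_polyVal_nonneg (k : ℕ) (c : ℝ) :
    IsClosed {a : Fin (k + 1) → ℝ | ∀ y ∈ Icc 0 c, 0 ≤ polyVal a y} := by
  simp only [ofPred_forall]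
  refine isClosed_iInter fun y => isClosed_iInter fun _ => isClosed_le continuous_const ?_
  unfold polyVal; fun_prop

/-- The normalized nonnegative polynomials form a compact set, on which the positive functional has
a positive minimum. -/
theorem exists_coercive {δ : Fin (k + 1) → ℝ} (hδ : δ ∈ momentInterior k) :
    ∃ ε > 0, ∀ a : Fin (k + 1) → ℝ, (∀ y ∈ Icc 0 (1 - δ 0), 0 ≤ polyVal a y) →
      ε * ‖a‖ ≤ momentFun δ a := by
  set S := Metric.sphere (0 : Fin (k + 1) → ℝ) 1 ∩
    {a | ∀ y ∈ Icc 0 (1 - δ 0), 0 ≤ polyVal a y} with hS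
  have hSc : IsCompact S := (isCompact_sphere _ _).inter_right (isClosed_polyVal_nonneg k _)
  have hSn : S.Nonempty := by
    refine ⟨Pi.single 0 1, ?_, fun y _ => ?_⟩
    · simp [Pi.norm_single]
    · rw [polyVal_single]; simp
  obtain ⟨b, hb, hmin⟩ := hSc.exists_isMinOn hSn (f := momentFun δ)
    (continuous_momentFun.comp (continuous_const.prodMk continuous_id)).continuousOn
  have hb0 : b ≠ 0 := by
    rintro rfl
    simpa using hb.1
  refine ⟨momentFun δ b, hδ.2.2 b hb0 hb.2, fun a ha => ?_⟩
  rcases eq_or_ne a 0 with rfl | ha0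
  · simp [momentFun]
  have hn : 0 < ‖a‖ := norm_pos_iff.2 ha0
  have h1 : ‖a‖⁻¹ • a ∈ S := by
    refine ⟨?_, fun y hy => ?_⟩
    · simp [norm_smul, hn.ne']
    · rw [polyVal_smul]; exact mul_nonneg (by positivity) (ha y hy)
  have h2 : momentFun δ b ≤ momentFun δ (‖a‖⁻¹ • a) := hmin h1
  rw [momentFun_smul] at h2
  calc momentFun δ b * ‖a‖ ≤ ‖a‖⁻¹ * momentFun δ a * ‖a‖ := by gcongr
    _ = momentFun δ a := by field_simp

/-- The dual functional, truncated. -/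
noncomputable def dualFun (δ : Fin (k + 1) → ℝ) (t : ℝ) (a : Fin (k + 1) → ℝ) : ℝ :=
  (∫ y in (0 : ℝ)..(1 - δ 0), -Real.log (1 - Real.exp (min (polyVal a y) (-t)))) - momentFun δ a

theorem continuous_log_trunc {t : ℝ} (ht : 0 < t) :
    Continuous fun u : ℝ => -Real.log (1 - Real.exp (min u (-t))) := by
  refine (Continuous.log (by fun_prop) fun u => ?_).neg
  exact (one_sub_exp_pos ((min_le_right u (-t)).trans_lt (by linarith))).ne'

theorem neg_log_one_sub_exp_nonneg {u : ℝ} (hu : u < 0) : 0 ≤ -Real.log (1 - Real.exp u) := by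
  rw [neg_nonneg]
  exact Real.log_nonpos (one_sub_exp_pos hu).le (by linarith [Real.exp_pos u])

theorem continuous_dualFun (δ : Fin (k + 1) → ℝ) {t : ℝ} (ht : 0 < t) :
    Continuous (dualFun δ t) := by
  refine Continuous.sub ?_ (continuous_momentFun.comp (continuous_const.prodMk continuous_id))
  refine intervalIntegral.continuous_parametric_intervalIntegral_of_continuous' ?_ 0 _
  exact (continuous_log_trunc ht).comp continuous_polyVal

theorem neg_momentFun_le_dualFun {δ : Fin (k + 1) → ℝ} (hδ : δ 0 ≤ 1) {t : ℝ} (ht : 0 < t)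
    (a : Fin (k + 1) → ℝ) : momentFun δ (-a) ≤ dualFun δ t a := by
  rw [momentFun_neg, dualFun]
  have : 0 ≤ ∫ y in (0 : ℝ)..(1 - δ 0), -Real.log (1 - Real.exp (min (polyVal a y) (-t))) :=
    intervalIntegral.integral_nonneg (by linarith) fun y _ =>
      neg_log_one_sub_exp_nonneg ((min_le_right _ (-t)).trans_lt (by linarith))
  linarith

/-- First variation of the dual functional at a constrained minimum. -/
theorem momentFun_le_of_isMin {δ : Fin (k + 1) → ℝ} (hδ : δ 0 ≤ 1) {t : ℝ} (ht : 0 < t)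
    {a q : Fin (k + 1) → ℝ} (ha : ∀ y ∈ Icc 0 (1 - δ 0), polyVal a y ≤ -t)
    (hq : ∀ᶠ s in 𝓝[>] (0 : ℝ), ∀ y ∈ Icc 0 (1 - δ 0), polyVal (a + s • q) y ≤ -t)
    (hmin : ∀ b, (∀ y ∈ Icc 0 (1 - δ 0), polyVal b y ≤ -t) → dualFun δ t a ≤ dualFun δ t b) :
    momentFun δ q ≤ ∫ y in (0 : ℝ)..(1 - δ 0), polyVal q y * bose (polyVal a y) := by
  have hc : 0 ≤ 1 - δ 0 := by linarith
  -- The tangent inequality is taken at the perturbed point `a + s • q`, which gives `s * momentFun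
  -- δ q ≤ s * J s` with no differentiation under the integral; then `s → 0`.
  set J : ℝ → ℝ := fun s =>
    ∫ y in (0 : ℝ)..(1 - δ 0), polyVal q y * boseTrunc t (polyVal (a + s • q) y) with hJ
  have hcont : Continuous (Function.uncurry fun s y : ℝ =>
      polyVal q y * boseTrunc t (polyVal (a + s • q) y)) := by
    refine ((continuous_polyVal_right q).comp continuous_snd).mul
      ((continuous_boseTrunc ht).comp (continuous_polyVal.comp (Continuous.prodMk ?_
        continuous_snd)))
    fun_prop
  have hJc : Continuous J :=
    intervalIntegral.continuous_parametric_intervalIntegral_of_continuous' hcont 0 _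
  have hJ0 : J 0 = ∫ y in (0 : ℝ)..(1 - δ 0), polyVal q y * bose (polyVal a y) := by
    refine intervalIntegral.integral_congr fun y hy => ?_
    rw [uIcc_of_le hc] at hy
    simp only [zero_smul, add_zero, boseTrunc_of_le (ha y hy)]
  rw [← hJ0]
  refine ge_of_tendsto ((hJc.tendsto 0).mono_left (nhdsWithin_le_nhds (s := Ioi 0))) ?_
  filter_upwards [hq, self_mem_nhdsWithin] with s hs hs0
  have hs0 : 0 < s := hs0
  have h1 := hmin _ hs
  have hi : ∀ b : Fin (k + 1) → ℝ, IntervalIntegrable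
      (fun y => -Real.log (1 - Real.exp (min (polyVal b y) (-t)))) volume 0 (1 - δ 0) :=
    fun b => ((continuous_log_trunc ht).comp (continuous_polyVal_right b)).intervalIntegrable _ _
  have hi2 : IntervalIntegrable
      (fun y => polyVal q y * boseTrunc t (polyVal (a + s • q) y)) volume 0 (1 - δ 0) :=
    (hcont.comp (Continuous.prodMk_right s)).intervalIntegrable _ _
  have h2 := intervalIntegral.integral_mono_on hc (hi (a + s • q))
    ((hi a).add (hi2.const_mul s)) fun y hy => by
      have h3 := neg_log_one_sub_exp_ge (u := polyVal (a + s • q) y) (v := polyVal a y)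
        (by linarith [hs y hy]) (by linarith [ha y hy])
      rw [min_eq_left (ha y hy), min_eq_left (hs y hy), boseTrunc_of_le (hs y hy)]
      have h4 : polyVal a y - polyVal (a + s • q) y = -(s * polyVal q y) := by
        rw [polyVal_add, polyVal_smul]; ring
      rw [h4] at h3
      linarith
  rw [intervalIntegral.integral_add (hi a) (hi2.const_mul s),
    intervalIntegral.integral_const_mul] at h2
  simp only [dualFun, momentFun_add, momentFun_smul] at h1
  have h5 : s * momentFun δ q ≤ s * J s := by simp only [hJ]; linarith
  exact le_of_mul_le_mul_left h5 hs0

/-- The dual functional is minimized over `p ≤ -t`. Moving in the direction `-1` is always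
admissible and bounds `∫ bose ∘ p` by `δ 0`; the margin then shows the constraint to be inactive, so
every direction is admissible and the moments match. -/
theorem exists_shapeDensities_eq {δ : Fin (k + 1) → ℝ} (hδ : δ ∈ momentInterior k) :
    ∃ a, IsEndpoint a (1 - δ 0) ∧ shapeDensities a (1 - δ 0) = δ := by
  obtain ⟨ε, hε, hco⟩ := exists_coercive hδ
  have hδ1 : δ 0 ≤ 1 := hδ.2.1.le
  set c := 1 - δ 0 with hc
  have hc0 : 0 < c := by linarith [hδ.2.1]
  have hc1 : c ≤ 1 := by linarith [hδ.1]
  set a₁ : Fin (k + 1) → ℝ := Pi.single 0 (-1) with ha₁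
  have hP1 : ∀ y, polyVal a₁ y = -1 := fun y => by rw [ha₁, polyVal_single]; simp
  set D₁ : ℝ := dualFun δ 1 a₁ with hD₁
  obtain ⟨t', ht', hmar⟩ := exists_margin k (D₁ / ε) (δ 0) hc0
  -- The radius `D₁ / ε` that determines `t'` must not depend on `t`. Since `t ≤ 1`, the constant
  -- polynomial `-1` is feasible and its dual value is `D₁` whatever `t` is.
  set t : ℝ := min (t' / 2) 1 with htdef
  have ht : 0 < t := lt_min (by linarith) one_pos
  have htt : t < t' := (min_le_left _ _).trans_lt (by linarith)
  set K : Set (Fin (k + 1) → ℝ) := {a | ∀ y ∈ Icc 0 c, polyVal a y ≤ -t} with hK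
  have hKcl : IsClosed K := by
    simp only [hK, ofPred_forall]
    refine isClosed_iInter fun y => isClosed_iInter fun _ => isClosed_le ?_ continuous_const
    unfold polyVal; fun_prop
  have hD1 : dualFun δ t a₁ = D₁ := by
    simp only [hD₁, dualFun, hP1]
    rw [min_eq_left (by linarith [min_le_right (t' / 2) 1]), min_self]
  have hbound : ∀ a ∈ K, ε * ‖a‖ ≤ dualFun δ t a := by
    intro a ha
    have h1 := hco (-a) fun y hy => by
      rw [polyVal_neg]; linarith [ha y hy]
    rw [norm_neg] at h1
    exact h1.trans (neg_momentFun_le_dualFun hδ1 ht a)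
  have ha₁K : a₁ ∈ K := fun y _ => by
    rw [hP1]; linarith [min_le_right (t' / 2) 1]
  have hcpt : IsCompact (Metric.closedBall (0 : Fin (k + 1) → ℝ) (D₁ / ε) ∩ K) :=
    (isCompact_closedBall _ _).inter_right hKcl
  have hball : ∀ a ∈ K, dualFun δ t a ≤ D₁ →
      a ∈ Metric.closedBall (0 : Fin (k + 1) → ℝ) (D₁ / ε) := by
    intro a ha h
    rw [mem_closedBall_zero_iff, le_div_iff₀ hε, mul_comm]
    exact (hbound a ha).trans h
  obtain ⟨a, ⟨haB, haK⟩, hmin⟩ := hcpt.exists_isMinOn ⟨a₁, hball a₁ ha₁K hD1.le, ha₁K⟩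
    (continuous_dualFun δ ht).continuousOn
  have hmin' : ∀ b, (∀ y ∈ Icc 0 (1 - δ 0), polyVal b y ≤ -t) →
      dualFun δ t a ≤ dualFun δ t b := by
    intro b hb
    rcases le_total (dualFun δ t b) D₁ with h | h
    · exact hmin ⟨hball b hb h, hb⟩
    · have : dualFun δ t a ≤ dualFun δ t a₁ := hmin ⟨hball a₁ ha₁K hD1.le, ha₁K⟩
      linarith
  have hneg : ∀ y ∈ Icc 0 c, polyVal a y < 0 := fun y hy => by linarith [haK y hy]
  have hint : ∫ y in (0 : ℝ)..c, bose (polyVal a y) ≤ δ 0 := by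
    have h := momentFun_le_of_isMin hδ1 ht haK (q := a₁) ?_ hmin'
    · simp only [hP1, neg_mul, one_mul, intervalIntegral.integral_neg] at h
      rw [ha₁, momentFun_single] at h
      simpa using h
    · filter_upwards [self_mem_nhdsWithin] with s hs y hy
      rw [polyVal_add, polyVal_smul, hP1]
      have hs : 0 < s := hs
      linarith [haK y hy]
  have hmar' := hmar a (mem_closedBall_zero_iff.1 haB) c ⟨le_rfl, hc1⟩ hneg hint
  have hall : ∀ q : Fin (k + 1) → ℝ,
      momentFun δ q ≤ ∫ y in (0 : ℝ)..c, polyVal q y * bose (polyVal a y) := by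
    intro q
    refine momentFun_le_of_isMin hδ1 ht haK ?_ hmin'
    have h1 : Tendsto (fun s : ℝ => s * (((k : ℝ) + 1) * ‖q‖)) (𝓝[>] 0) (𝓝 0) := by
      have : Continuous fun s : ℝ => s * (((k : ℝ) + 1) * ‖q‖) := by fun_prop
      simpa using (this.tendsto 0).mono_left nhdsWithin_le_nhds
    filter_upwards [self_mem_nhdsWithin, h1.eventually_lt_const (sub_pos.2 htt)] with s hs hs1 y hy
    have hs : 0 < s := hs
    rw [polyVal_add, polyVal_smul]
    have h2 := (abs_le.1 (abs_polyVal_le q (y := y) ⟨hy.1, hy.2.trans hc1⟩)).2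
    have h3 := mul_le_mul_of_nonneg_left h2 hs.le
    linarith [hmar' y hy]
  have hmom : ∀ i : Fin (k + 1),
      ∫ y in (0 : ℝ)..c, y ^ (i : ℕ) * bose (polyVal a y) = δ i / ((i : ℕ) + 1) := by
    intro i
    have h1 := hall (Pi.single i 1)
    have h2 := hall (Pi.single i (-1))
    simp only [momentFun_single, polyVal_single, one_mul, neg_mul,
      intervalIntegral.integral_neg] at h1 h2
    linarith
  refine ⟨a, ⟨hc0.le, hneg, ?_⟩, ?_⟩
  · have := hmom 0
    simp only [Fin.val_zero, pow_zero, one_mul] at this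
    rw [this, hc]; simp
  · ext i
    rw [shapeDensities, hmom i]
    field_simp

end Dual

section Entropy

open Filter Topology

variable {k : ℕ}

/-! ### Entropy maximizers -/

theorem mul_log_sub_le {q r : ℝ} (hq : 0 ≤ q) (hr : 0 < r) :
    q * Real.log r - q * Real.log q ≤ r - q := by
  rcases hq.eq_or_lt with rfl | hq
  · simpa using hr.le
  have h := mul_le_mul_of_nonneg_left (Real.log_le_sub_one_of_pos (div_pos hr hq)) hq.le
  rw [Real.log_div hr.ne' hq.ne', mul_sub, mul_sub, mul_div_cancel₀ _ hq.ne'] at h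
  linarith

theorem mul_log_sub_lt {q r : ℝ} (hq : 0 ≤ q) (hr : 0 < r) (hne : q ≠ r) :
    q * Real.log r - q * Real.log q < r - q := by
  rcases hq.eq_or_lt with rfl | hq
  · simpa using hr
  have h1 : r / q ≠ 1 := by rw [Ne, div_eq_one_iff_eq hq.ne']; exact hne.symm
  have h := mul_lt_mul_of_pos_left (Real.log_lt_sub_one_of_pos (div_pos hr hq) h1) hq
  rw [Real.log_div hr.ne' hq.ne', mul_sub, mul_sub, mul_div_cancel₀ _ hq.ne'] at h
  linarith

theorem binEntropy_eq_sub (q : ℝ) :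
    Real.binEntropy q = -(q * Real.log q) - (1 - q) * Real.log (1 - q) := by
  rw [Real.binEntropy, Real.log_inv, Real.log_inv]; ring

/-- Gibbs' inequality for a Bernoulli variable. -/
theorem binEntropy_le {q u : ℝ} (hq : q ∈ Icc (0 : ℝ) 1) (hu : u < 0) :
    Real.binEntropy q ≤ -(u * (1 - q)) + -Real.log (1 - Real.exp u) * q := by
  have h1 := mul_log_sub_le hq.1 (one_sub_exp_pos hu)
  have h2 := mul_log_sub_le (q := 1 - q) (by linarith [hq.2]) (Real.exp_pos u)
  rw [Real.log_exp] at h2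
  rw [binEntropy_eq_sub]
  linarith

theorem eq_of_binEntropy_eq {q u : ℝ} (hq : q ∈ Icc (0 : ℝ) 1) (hu : u < 0)
    (h : Real.binEntropy q = -(u * (1 - q)) + -Real.log (1 - Real.exp u) * q) :
    q = 1 - Real.exp u := by
  by_contra hne
  have h1 := mul_log_sub_lt hq.1 (one_sub_exp_pos hu) hne
  have h2 := mul_log_sub_le (q := 1 - q) (by linarith [hq.2]) (Real.exp_pos u)
  rw [Real.log_exp] at h2
  rw [binEntropy_eq_sub] at h
  linarith

theorem binEntropy_one_sub_exp (u : ℝ) : Real.binEntropy (1 - Real.exp u) =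
    -(u * (1 - (1 - Real.exp u))) + -Real.log (1 - Real.exp u) * (1 - Real.exp u) := by
  rw [binEntropy_eq_sub, sub_sub_cancel, Real.log_exp]; ring

variable {f : ℝ → ℝ} {a : Fin (k + 1) → ℝ} {c t : ℝ}

theorem IsSublebesgue.intervalIntegrable_binEntropy (hf : IsSublebesgue f) :
    IntervalIntegrable (fun x => Real.binEntropy (f x)) volume 0 1 := by
  rw [intervalIntegrable_iff_integrableOn_Ioc_of_le zero_le_one]
  refine Measure.integrableOn_of_bounded (M := Real.log 2) (by simp)
    (Real.binEntropy_continuous.measurable.comp hf.1).aestronglyMeasurable ?_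
  filter_upwards [ae_restrict_mem measurableSet_Ioc] with x hx
  have h := hf.2 x ⟨hx.1.le, hx.2⟩
  rw [Real.norm_eq_abs, abs_of_nonneg (Real.binEntropy_nonneg h.1 h.2)]
  exact Real.binEntropy_le_log_two

/-- The integrand of the dual upper bound for the entropy. -/
noncomputable def dualIntegrand (a : Fin (k + 1) → ℝ) (t : ℝ) (f : ℝ → ℝ) (x : ℝ) : ℝ :=
  -(polyVal a (distrib f x) * (1 - f x)) +
    -Real.log (1 - Real.exp (min (polyVal a (distrib f x)) (-t))) * f x

theorem IsSublebesgue.intervalIntegrable_dualIntegrand (hf : IsSublebesgue f)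
    (a : Fin (k + 1) → ℝ) (ht : 0 < t) :
    IntervalIntegrable (dualIntegrand a t f) volume 0 1 :=
  (hf.intervalIntegrable_comp_distrib_mul (continuous_polyVal_right a).continuousOn
    hf.one_sub).neg.add
  (hf.intervalIntegrable_comp_distrib_mul (φ := fun y =>
    -Real.log (1 - Real.exp (min (polyVal a y) (-t))))
    ((continuous_log_trunc ht).comp (continuous_polyVal_right a)).continuousOn hf)

/-- The dual bound depends on `f` only through its densities: the first term is a moment, and the
second becomes a Lebesgue integral over `[0, 1 - δ 0]`. -/
theorem IsSublebesgue.integral_dualIntegrand (hf : IsSublebesgue f) (a : Fin (k + 1) → ℝ)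
    (ht : 0 < t) : ∫ x in (0 : ℝ)..1, dualIntegrand a t f x = dualFun (densities k f) t a := by
  have hi1 := hf.intervalIntegrable_comp_distrib_mul (continuous_polyVal_right a).continuousOn
    hf.one_sub
  have hi2 := hf.intervalIntegrable_comp_distrib_mul (φ := fun y =>
    -Real.log (1 - Real.exp (min (polyVal a y) (-t))))
    ((continuous_log_trunc ht).comp (continuous_polyVal_right a)).continuousOn hf
  have h := hf.integral_comp_distrib_mul (φ := fun y =>
    -Real.log (1 - Real.exp (min (polyVal a y) (-t))))
    ((continuous_log_trunc ht).comp (continuous_polyVal_right a)) (x := 1) (by simp)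
  unfold dualIntegrand
  refine (intervalIntegral.integral_add hi1.neg hi2).trans ?_
  simp only [Pi.neg_apply]
  rw [intervalIntegral.integral_neg, hf.integral_polyVal, h, dualFun, ← hf.distrib_one]
  ring

theorem IsSublebesgue.binEntropy_le_dualIntegrand (hf : IsSublebesgue f)
    (ht : 0 < t) (hneg : ∀ y ∈ Icc 0 (distrib f 1), polyVal a y ≤ -t) {x : ℝ}
    (hx : x ∈ Icc (0 : ℝ) 1) : Real.binEntropy (f x) ≤ dualIntegrand a t f x := by
  have h1 := hneg _ (hf.distrib_mem hx)
  rw [dualIntegrand, min_eq_left h1]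
  exact binEntropy_le (hf.2 x hx) (by linarith)

theorem IsSublebesgue.entropy_le (hf : IsSublebesgue f)
    (ht : 0 < t) (hneg : ∀ y ∈ Icc 0 (distrib f 1), polyVal a y ≤ -t) :
    entropy f ≤ dualFun (densities k f) t a := by
  rw [← hf.integral_dualIntegrand a ht]
  exact intervalIntegral.integral_mono_on zero_le_one hf.intervalIntegrable_binEntropy
    (hf.intervalIntegrable_dualIntegrand a ht) fun x hx =>
      hf.binEntropy_le_dualIntegrand ht hneg hx

theorem IsSublebesgue.entropy_eq (hf : IsSublebesgue f)
    (ht : 0 < t) (hneg : ∀ y ∈ Icc 0 (distrib f 1), polyVal a y ≤ -t)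
    (h : ∀ x ∈ Icc (0 : ℝ) 1, f x = 1 - Real.exp (polyVal a (distrib f x))) :
    entropy f = dualFun (densities k f) t a := by
  rw [← hf.integral_dualIntegrand a ht]
  refine intervalIntegral.integral_congr fun x hx => ?_
  rw [uIcc_of_le zero_le_one] at hx
  simp only [dualIntegrand]
  rw [min_eq_left (hneg _ (hf.distrib_mem hx)), h x hx]
  exact binEntropy_one_sub_exp _

theorem IsSublebesgue.sameMeasure_of_entropy_eq (hf : IsSublebesgue f)
    (ht : 0 < t) (hneg : ∀ y ∈ Icc 0 (distrib f 1), polyVal a y ≤ -t)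
    (h : dualFun (densities k f) t a ≤ entropy f) :
    SameMeasure f fun x => 1 - Real.exp (polyVal a (distrib f x)) := by
  have hi1 := hf.intervalIntegrable_dualIntegrand a ht
  have hi2 := hf.intervalIntegrable_binEntropy
  have h0 : ∫ x in (0 : ℝ)..1, (dualIntegrand a t f x - Real.binEntropy (f x)) = 0 := by
    rw [intervalIntegral.integral_sub hi1 hi2, hf.integral_dualIntegrand a ht]
    exact sub_eq_zero.2 (le_antisymm h (hf.entropy_le ht hneg))
  rw [intervalIntegral.integral_eq_zero_iff_of_le_of_nonneg_ae zero_le_one ?_ (hi1.sub hi2)] at h0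
  · rw [SameMeasure, ← Measure.restrict_congr_set Ioc_ae_eq_Icc]
    filter_upwards [h0, ae_restrict_mem measurableSet_Ioc] with x hx hxI
    have hxI' : x ∈ Icc (0 : ℝ) 1 := ⟨hxI.1.le, hxI.2⟩
    have hn := hneg _ (hf.distrib_mem hxI')
    refine eq_of_binEntropy_eq (hf.2 x hxI') (by linarith) ?_
    have hx : dualIntegrand a t f x - Real.binEntropy (f x) = 0 := hx
    rw [dualIntegrand, min_eq_left hn] at hx
    linarith
  · filter_upwards [ae_restrict_mem measurableSet_Ioc] with x hxI
    exact sub_nonneg.2 (hf.binEntropy_le_dualIntegrand ht hneg ⟨hxI.1.le, hxI.2⟩)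

theorem shapeDensities_zero (h : IsEndpoint a c) : shapeDensities a c 0 = 1 - c := by
  simpa [shapeDensities] using h.integral_bose

/-- Every polynomial has a shape, and it is the unique entropy maximizer for its densities. -/
theorem IsEndpoint.exists_isLimitShape {p : NegPoly k} (h : IsEndpoint p.1 c) :
    ∃ f, IsLimitShape k (shapeDensities p.1 c) f ∧ ∀ g,
      IsLimitShape k (shapeDensities p.1 c) g → SameMeasure f g ∧ HasInverseSlope g p := by
  obtain ⟨f, hf, hfc, hfa⟩ := h.exists_isSublebesgue
  have hfs : SameMeasure f fun x => 1 - Real.exp (polyVal p.1 (distrib f x)) := by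
    filter_upwards [ae_restrict_mem measurableSet_Icc] with x hx using hfa x hx
  have hfd : densities k f = shapeDensities p.1 c := by
    rw [(h.hasInverseSlope hf hfc hfs).densities_eq hf, hfc]
  obtain ⟨t, ht, hneg⟩ := h.exists_le_neg
  have hent := hf.entropy_eq ht (by rwa [hfc]) hfa
  rw [hfd] at hent
  have hc : ∀ g, IsSublebesgue g → densities k g = shapeDensities p.1 c → distrib g 1 = c := by
    intro g hg hgd
    rw [hg.distrib_one k, hgd, shapeDensities_zero h]; ring
  have hfl : IsLimitShape k (shapeDensities p.1 c) f := by
    refine ⟨hf, hfd, fun g hg hgd => ?_⟩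
    rw [hent, ← hgd]
    exact hg.entropy_le ht (by rwa [hc g hg hgd])
  refine ⟨f, hfl, fun g hg => ?_⟩
  have hgc := hc g hg.1 hg.2.1
  have hgs : SameMeasure g fun x => 1 - Real.exp (polyVal p.1 (distrib g x)) := by
    refine hg.1.sameMeasure_of_entropy_eq ht (by rwa [hgc]) ?_
    rw [hg.2.1, ← hent]
    exact hg.2.2 f hf hfd
  exact ⟨SameMeasure.of_profile hf hg.1 h hfc hgc hfs hgs, h.hasInverseSlope hg.1 hgc hgs⟩

theorem IsEndpoint.coeff_zero_neg (h : IsEndpoint a c) : a 0 < 0 := by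
  rw [← polyVal_zero_right a]; exact h.neg 0 ⟨le_rfl, h.nonneg⟩

theorem limitShape_of_mem_momentInterior {δ : Fin (k + 1) → ℝ} (hδ : δ ∈ momentInterior k) :
    (∃ f, IsLimitShape k δ f) ∧
      (∀ f g, IsLimitShape k δ f → IsLimitShape k δ g → SameMeasure f g) ∧
      (∀ f, IsLimitShape k δ f → ∃ p : NegPoly k, HasInverseSlope f p) := by
  obtain ⟨a, ha, hd⟩ := exists_shapeDensities_eq hδ
  obtain ⟨f, hf, hall⟩ := IsEndpoint.exists_isLimitShape (p := ⟨a, ha.coeff_zero_neg⟩) ha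
  simp only [hd] at hf hall
  exact ⟨⟨f, hf⟩, fun g g' hg hg' => (hall g hg).1.symm.trans (hall g' hg').1,
    fun g hg => ⟨_, (hall g hg).2⟩⟩

end Entropy

section Interior

open Filter Topology

variable {k : ℕ}

/-! ### The interior of the feasible region -/

/-- The polynomial with coefficients `a`. -/
noncomputable def toPoly (a : Fin (k + 1) → ℝ) : Polynomial ℝ :=
  ∑ i, Polynomial.C (a i) * Polynomial.X ^ (i : ℕ)

theorem eval_toPoly (a : Fin (k + 1) → ℝ) (y : ℝ) : (toPoly a).eval y = polyVal a y := by
  simp [toPoly, polyVal, Polynomial.eval_finsetSum]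

theorem coeff_toPoly (a : Fin (k + 1) → ℝ) (i : Fin (k + 1)) : (toPoly a).coeff i = a i := by
  simp [toPoly, Polynomial.coeff_X_pow, Fin.val_inj]

theorem natDegree_toPoly_le (a : Fin (k + 1) → ℝ) : (toPoly a).natDegree ≤ k :=
  Polynomial.natDegree_sum_le_of_forall_le _ _ fun i _ =>
    (Polynomial.natDegree_C_mul_X_pow_le _ _).trans (Nat.lt_succ_iff.1 i.2)

theorem toPoly_ne_zero {a : Fin (k + 1) → ℝ} (ha : a ≠ 0) : toPoly a ≠ 0 := fun h => ha <| by
  ext i; rw [← coeff_toPoly a, h]; simp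

theorem eq_zero_of_polyVal_eq_zero {a : Fin (k + 1) → ℝ} {c : ℝ} (hc : 0 < c)
    (h : ∀ y ∈ Icc 0 c, polyVal a y = 0) : a = 0 := by
  by_contra ha
  refine toPoly_ne_zero ha (Polynomial.eq_zero_of_infinite_isRoot _ ?_)
  refine (Icc_infinite hc).mono fun y hy => ?_
  rw [mem_ofPred_eq, Polynomial.IsRoot.def, eval_toPoly, h y hy]

theorem momentFun_nonneg {δ : Fin (k + 1) → ℝ} (hδ : δ ∈ feasible k) {a : Fin (k + 1) → ℝ}
    (ha : ∀ y ∈ Icc 0 (1 - δ 0), 0 ≤ polyVal a y) : 0 ≤ momentFun δ a := by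
  obtain ⟨f, hf, rfl⟩ := mem_feasible.1 hδ
  rw [← hf.integral_polyVal]
  rw [← hf.distrib_one] at ha
  exact intervalIntegral.integral_nonneg zero_le_one fun x hx =>
    mul_nonneg (ha _ (hf.distrib_mem hx)) (hf.one_sub.2 x hx).1

theorem momentFun_add_left (δ e a : Fin (k + 1) → ℝ) :
    momentFun (δ + e) a = momentFun δ a + momentFun e a := by
  simp [momentFun, add_div, mul_add, Finset.sum_add_distrib]

theorem bounds_of_closedBall {δ : Fin (k + 1) → ℝ} {r : ℝ} (hr : 0 < r)
    (h : Metric.closedBall δ r ⊆ feasible k) : r ≤ δ 0 ∧ δ 0 ≤ 1 - r := by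
  have h1 : ∀ s, |s| ≤ r → δ + Pi.single 0 s ∈ feasible k := fun s hs => h <| by
    simpa [Pi.norm_single] using hs
  have h2 := ((h1 r (abs_of_pos hr).le).1 0).2
  have h3 := ((h1 (-r) (by rw [abs_neg, abs_of_pos hr])).1 0).1
  simp only [Pi.add_apply, Pi.single_eq_same] at h2 h3
  constructor <;> linarith

/-- Coercivity of the moment functional, uniform over centres of feasible balls. -/
theorem exists_coercive_of_closedBall (k : ℕ) {r : ℝ} (hr : 0 < r) :
    ∃ C > 0, ∀ δ : Fin (k + 1) → ℝ, Metric.closedBall δ r ⊆ feasible k →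
      ∀ a : Fin (k + 1) → ℝ, (∀ y ∈ Icc 0 (1 - δ 0), 0 ≤ polyVal a y) →
        ‖a‖ ≤ C * momentFun δ a := by
  set r' : ℝ := r / ((k : ℝ) + 1) with hr'
  have hr'0 : 0 < r' := by positivity
  refine ⟨(1 / r' + 1) / r + 1 / r', by positivity, fun δ hball a ha => ?_⟩
  obtain ⟨hb1, hb2⟩ := bounds_of_closedBall hr hball
  have hδf : δ ∈ feasible k := hball (Metric.mem_closedBall_self hr.le)
  set A : ℝ := ∑ i : Fin k, |a i.succ| with hA
  have ha0 : 0 ≤ a 0 := by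
    rw [← polyVal_zero_right a]
    exact ha 0 ⟨le_rfl, by linarith⟩
  -- A perturbation against the signs of the higher coefficients lowers the functional by at least
  -- `r' * A`, yet leaves it nonnegative, so `A` is controlled. The entry `0` keeps the interval
  -- `[0, 1 - δ 0]` unchanged; `a 0` is then controlled through `r ≤ δ 0`.
  set e : Fin (k + 1) → ℝ := Fin.cons 0 fun i => -(r * SignType.sign (a i.succ)) with he
  have hsign : ∀ x : ℝ, |((SignType.sign x : SignType) : ℝ)| ≤ 1 := fun x => by
    rcases lt_trichotomy x 0 with h | h | h <;> simp [h]
  have hee : δ + e ∈ feasible k := by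
    refine hball ?_
    rw [mem_closedBall_iff_norm, add_sub_cancel_left, pi_norm_le_iff_of_nonneg hr.le]
    intro i
    refine Fin.cases ?_ (fun i => ?_) i
    · simpa [he] using hr.le
    · simp only [he, Fin.cons_succ, norm_neg, norm_mul, Real.norm_eq_abs, abs_of_pos hr]
      exact mul_le_of_le_one_right hr.le (hsign _)
  have h1 : 0 ≤ momentFun (δ + e) a := momentFun_nonneg hee (by simpa [he] using ha)
  have h2 : momentFun e a ≤ -(r' * A) := by
    rw [momentFun, Fin.sum_univ_succ, hA, Finset.mul_sum, ← Finset.sum_neg_distrib]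
    simp only [he, Fin.cons_zero, Fin.cons_succ, zero_div, mul_zero, zero_add]
    refine Finset.sum_le_sum fun i _ => ?_
    have h3 : a i.succ * (-(r * ((SignType.sign (a i.succ) : SignType) : ℝ)) /
        (((i.succ : Fin (k + 1)) : ℕ) + 1)) =
        -(r / ((((i.succ : Fin (k + 1)) : ℕ) : ℝ) + 1) * |a i.succ|) := by
      rw [← self_mul_sign (a i.succ)]; ring
    rw [h3, neg_le_neg_iff, hr']
    gcongr
    exact_mod_cast Nat.lt_succ_iff.1 i.succ.2
  have h4 : a 0 * δ 0 - A ≤ momentFun δ a := by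
    rw [momentFun, Fin.sum_univ_succ, hA, sub_eq_add_neg, ← Finset.sum_neg_distrib]
    refine add_le_add (by simp) (Finset.sum_le_sum fun i _ => ?_)
    have h5 := hδf.1 i.succ
    have h6 : δ i.succ / ((((i.succ : Fin (k + 1)) : ℕ) : ℝ) + 1) ≤ 1 := by
      rw [div_le_one (by positivity)]
      have : (0 : ℝ) ≤ (((i.succ : Fin (k + 1)) : ℕ) : ℝ) := by positivity
      linarith [h5.2]
    have h7 : 0 ≤ δ i.succ / ((((i.succ : Fin (k + 1)) : ℕ) : ℝ) + 1) :=
      div_nonneg h5.1 (by positivity)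
    have h8 := neg_abs_le (a i.succ)
    nlinarith [abs_nonneg (a i.succ)]
  rw [momentFun_add_left] at h1
  have hA0 : 0 ≤ A := Finset.sum_nonneg fun i _ => abs_nonneg _
  have hn : ‖a‖ ≤ a 0 + A := by
    rw [pi_norm_le_iff_of_nonneg (by positivity)]
    intro i
    refine Fin.cases ?_ (fun i => ?_) i
    · rw [Real.norm_eq_abs, abs_of_nonneg ha0]; linarith
    · have := Finset.single_le_sum (f := fun i : Fin k => |a i.succ|)
        (fun i _ => abs_nonneg _) (Finset.mem_univ i)
      rw [Real.norm_eq_abs]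
      linarith
  have h9 : A ≤ 1 / r' * momentFun δ a := by
    rw [one_div, ← div_eq_inv_mul, le_div_iff₀ hr'0]; linarith
  have h10 : a 0 ≤ (1 / r' + 1) / r * momentFun δ a := by
    rw [div_mul_eq_mul_div, le_div_iff₀ hr]
    nlinarith
  rw [add_mul]
  linarith

theorem interior_feasible_subset (k : ℕ) : interior (feasible k) ⊆ momentInterior k := by
  intro δ hδ
  obtain ⟨r, hr, hball⟩ := Metric.nhds_basis_closedBall.mem_iff.1
    (mem_interior_iff_mem_nhds.1 hδ)
  obtain ⟨hb1, hb2⟩ := bounds_of_closedBall hr hball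
  obtain ⟨C, hC, hco⟩ := exists_coercive_of_closedBall k hr
  refine ⟨by linarith, by linarith, fun a ha hpos => ?_⟩
  have h := hco δ hball a hpos
  exact pos_of_mul_pos_right ((norm_pos_iff.2 ha).trans_le h) hC.le

/-- Normalized polynomials witnessing failure along an ultrafilter converging to `δ` have, by
compactness of the sphere, a limit witnessing failure at `δ`. -/
theorem isOpen_momentInterior (k : ℕ) : IsOpen (momentInterior k) := by
  rw [isOpen_iff_ultrafilter]
  intro δ hδ l hl
  by_contra hnot
  have hnot' := Ultrafilter.compl_mem_iff_notMem.2 hnot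
  have he0 : Tendsto (fun d : Fin (k + 1) → ℝ => d 0) l (𝓝 (δ 0)) :=
    ((continuous_apply 0).tendsto δ).mono_left hl
  have hex : ∀ᶠ d in (l : Filter (Fin (k + 1) → ℝ)), ∃ a ∈ Metric.sphere (0 : Fin (k + 1) → ℝ) 1,
      (∀ y ∈ Icc 0 (1 - d 0), 0 ≤ polyVal a y) ∧ momentFun d a ≤ 0 := by
    filter_upwards [hnot', he0.eventually_const_lt hδ.1, he0.eventually_lt_const hδ.2.1]
      with d hd h0 h1
    have hd' : ¬ d ∈ momentInterior k := hd
    simp only [momentInterior, mem_ofPred_eq, h0, h1, true_and] at hd'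
    push Not at hd'
    obtain ⟨a, ha, hpos, hle⟩ := hd'
    have hn : 0 < ‖a‖ := norm_pos_iff.2 ha
    refine ⟨‖a‖⁻¹ • a, by simp [norm_smul, hn.ne'], fun y hy => ?_, ?_⟩
    · rw [polyVal_smul]; exact mul_nonneg (by positivity) (hpos y hy)
    · rw [momentFun_smul]; exact mul_nonpos_of_nonneg_of_nonpos (by positivity) hle
  obtain ⟨a, hev⟩ := hex.choice
  obtain ⟨b, hbS, hb⟩ := (isCompact_sphere (0 : Fin (k + 1) → ℝ) 1).ultrafilter_le_nhds'
    (l.map a) (hev.mono fun d hd => hd.1)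
  have hab : Tendsto a l (𝓝 b) := hb
  have hb0 : b ≠ 0 := by
    rintro rfl
    simp at hbS
  have hpos : ∀ y ∈ Icc 0 (1 - δ 0), 0 ≤ polyVal b y := by
    intro y hy
    have h2 : Tendsto (fun d : Fin (k + 1) → ℝ => min (1 - d 0) y) l (𝓝 y) := by
      simpa [min_eq_right hy.2] using (he0.const_sub 1).min (tendsto_const_nhds (x := y))
    have h3 : Tendsto (fun d => polyVal (a d) (min (1 - d 0) y)) l (𝓝 (polyVal b y)) :=
      (continuous_polyVal.tendsto (b, y)).comp (hab.prodMk_nhds h2)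
    refine ge_of_tendsto h3 ?_
    filter_upwards [hev, he0.eventually_lt_const hδ.2.1] with d hd hd1
    exact hd.2.1 _ ⟨le_min (by linarith) hy.1, min_le_left _ _⟩
  have hle : momentFun δ b ≤ 0 := by
    have h3 : Tendsto (fun d => momentFun d (a d)) l (𝓝 (momentFun δ b)) :=
      (continuous_momentFun.tendsto (δ, b)).comp ((tendsto_id'.2 hl).prodMk_nhds hab)
    exact le_of_tendsto h3 (hev.mono fun d hd => hd.2.2)
  exact absurd (hδ.2.2 b hb0 hpos) (not_lt.2 hle)

/-- That every strictly positive vector is feasible comes from the entropy maximizer constructed for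
it. -/
theorem interior_feasible (k : ℕ) : interior (feasible k) = momentInterior k := by
  refine (interior_feasible_subset k).antisymm (interior_maximal ?_ (isOpen_momentInterior k))
  intro δ hδ
  obtain ⟨f, hf⟩ := (limitShape_of_mem_momentInterior hδ).1
  exact mem_feasible.2 ⟨f, hf.1, hf.2.1⟩

/-! ### The parametrization by polynomials -/

variable {a : Fin (k + 1) → ℝ} {c : ℝ}

theorem momentFun_shapeDensities (h : IsEndpoint a c) (b : Fin (k + 1) → ℝ) :
    momentFun (shapeDensities a c) b = ∫ y in (0 : ℝ)..c, polyVal b y * bose (polyVal a y) := by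
  have h1 : ∀ y, polyVal b y * bose (polyVal a y) =
      ∑ i : Fin (k + 1), b i * (y ^ (i : ℕ) * bose (polyVal a y)) := fun y => by
    simp [polyVal, Finset.sum_mul, mul_assoc]
  simp only [h1]
  rw [intervalIntegral.integral_finsetSum]
  · refine Finset.sum_congr rfl fun i _ => ?_
    rw [intervalIntegral.integral_const_mul, shapeDensities]
    field_simp
  · exact fun i _ => (intervalIntegrable_bose h.nonneg h.neg (continuous_pow _)).const_mul _

theorem shapeDensities_mem (h : IsEndpoint a c) : shapeDensities a c ∈ momentInterior k := by
  refine ⟨?_, ?_, fun b hb hpos => ?_⟩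
  · rw [shapeDensities_zero h]; linarith [h.lt_one]
  · rw [shapeDensities_zero h]; linarith [h.pos]
  · rw [shapeDensities_zero h, sub_sub_cancel] at hpos
    rw [momentFun_shapeDensities h]
    refine intervalIntegral.integral_pos h.pos ?_ (fun y hy => ?_) ?_
    · exact (continuous_polyVal_right b).continuousOn.mul (continuousOn_bose_polyVal h.neg)
    · exact mul_nonneg (hpos y ⟨hy.1.le, hy.2⟩) (bose_pos (h.neg y ⟨hy.1.le, hy.2⟩)).le
    · by_contra! hcon
      refine hb (eq_zero_of_polyVal_eq_zero h.pos fun y hy => le_antisymm ?_ (hpos y hy))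
      exact nonpos_of_mul_nonpos_left (hcon y hy) (bose_pos (h.neg y hy))

/-- The point is a negative upper bound for the `a j` uniform in `j`: from `exists_margin` if `c₀ >
0`, and from `a₀ 0 < 0` near the origin if `c₀ = 0`. The two alternatives of `h0` serve continuity
of the inverse map and of the map itself. -/
theorem IsEndpoint.of_tendsto {ι : Type*} {l : Filter ι} [l.NeBot] {a : ι → Fin (k + 1) → ℝ}
    {c : ι → ℝ} {a₀ : Fin (k + 1) → ℝ} {c₀ : ℝ} (ha : Tendsto a l (𝓝 a₀))
    (hc : Tendsto c l (𝓝 c₀)) (h : ∀ᶠ j in l, IsEndpoint (a j) (c j)) (h0 : 0 < c₀ ∨ a₀ 0 < 0) :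
    IsEndpoint a₀ c₀ ∧
      Tendsto (fun j => shapeDensities (a j) (c j)) l (𝓝 (shapeDensities a₀ c₀)) := by
  have hc₀ : 0 ≤ c₀ := ge_of_tendsto hc (h.mono fun j hj => hj.nonneg)
  have key : ∃ t > 0, ∀ᶠ j in l, 0 ≤ c j ∧ ∀ y ∈ Icc 0 (c j), polyVal (a j) y ≤ -t := by
    rcases hc₀.eq_or_lt with hz | hpos
    · have h0' : a₀ 0 < 0 := h0.resolve_left (by rw [← hz]; exact lt_irrefl 0)
      have h1 : ∀ᶠ q in 𝓝 (a₀, (0 : ℝ)), polyVal q.1 q.2 < a₀ 0 / 2 := by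
        refine (continuous_polyVal.tendsto (a₀, (0 : ℝ))).eventually_lt_const ?_
        simp only [polyVal_zero_right]; linarith
      rw [nhds_prod_eq] at h1
      obtain ⟨pa, hpa, pb, hpb, hab⟩ := Filter.eventually_prod_iff.1 h1
      obtain ⟨η, hη, hηb⟩ := Metric.eventually_nhds_iff.1 hpb
      refine ⟨-(a₀ 0 / 2), by linarith, ?_⟩
      rw [← hz] at hc
      filter_upwards [h, ha.eventually hpa, hc.eventually_lt_const hη] with j hj hja hjc
      refine ⟨hj.nonneg, fun y hy => ?_⟩
      rw [neg_neg]
      refine (hab hja (hηb ?_)).le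
      rw [Real.dist_eq, sub_zero, abs_of_nonneg hy.1]
      exact hy.2.trans_lt hjc
    · obtain ⟨t, ht, hmar⟩ := exists_margin k (‖a₀‖ + 1) 1 (half_pos hpos)
      refine ⟨t, ht, ?_⟩
      filter_upwards [h, ha.norm.eventually_lt_const (lt_add_one ‖a₀‖),
        hc.eventually_const_lt (half_lt_self hpos)] with j hj hja hjc
      refine ⟨hj.nonneg, hmar _ hja.le _ ⟨hjc.le, hj.le_one⟩ hj.neg ?_⟩
      linarith [hj.integral_bose, hj.nonneg]
  obtain ⟨t, ht, hev⟩ := key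
  obtain ⟨h1, h2⟩ := tendsto_integral_bose ht ha hc hev
  refine ⟨⟨hc₀, fun y hy => by linarith [h1 y hy], ?_⟩, ?_⟩
  · have h3 := hc.add (h2 0)
    simp only [pow_zero, one_mul] at h3
    refine tendsto_nhds_unique h3 (tendsto_const_nhds.congr' ?_)
    filter_upwards [h] with j hj using hj.integral_eq.symm
  · exact tendsto_pi_nhds.2 fun i => (h2 (i : ℕ)).const_mul _

/-- The point where the inverse distribution function of shape `p` takes the value `1`. -/
noncomputable def endpoint (p : NegPoly k) : ℝ := (exists_isEndpoint p.2).choose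

theorem isEndpoint_endpoint (p : NegPoly k) : IsEndpoint p.1 (endpoint p) :=
  (exists_isEndpoint p.2).choose_spec

/-- Endpoints stay in the compact `[0, 1]`, and any cluster point is the endpoint of the limit
polynomial, which is unique. -/
theorem continuous_endpoint : Continuous (endpoint (k := k)) := by
  rw [continuous_iff_continuousAt]
  intro p
  refine isCompact_Icc.tendsto_nhds_of_unique_mapClusterPt (s := Icc (0 : ℝ) 1)
    (Eventually.of_forall fun q =>
      ⟨(isEndpoint_endpoint q).nonneg, (isEndpoint_endpoint q).le_one⟩) fun x _ hx => ?_
  obtain ⟨U, hU, hUx⟩ := mapClusterPt_iff_ultrafilter.1 hx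
  have h := IsEndpoint.of_tendsto (l := (U : Filter (NegPoly k)))
    ((continuous_subtype_val.tendsto p).mono_left hU) hUx
    (Eventually.of_forall isEndpoint_endpoint) (Or.inr p.2)
  exact h.1.unique (isEndpoint_endpoint p)

/-- The density vector of the shape `p`. -/
noncomputable def polyDensities (p : NegPoly k) : momentInterior k :=
  ⟨shapeDensities p.1 (endpoint p), shapeDensities_mem (isEndpoint_endpoint p)⟩

theorem continuous_polyDensities : Continuous (polyDensities (k := k)) := by
  refine Continuous.subtype_mk ?_ _
  rw [continuous_iff_continuousAt]
  intro p
  exact (IsEndpoint.of_tendsto (continuous_subtype_val.tendsto p) (continuous_endpoint.tendsto p)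
    (Eventually.of_forall isEndpoint_endpoint) (Or.inr p.2)).2

/-- Equal densities have a common entropy maximizer, whose inverse distribution function has only
one derivative; so the two polynomials agree on an interval of positive length. -/
theorem injective_polyDensities : Function.Injective (polyDensities (k := k)) := by
  intro p q hpq
  have hd : shapeDensities p.1 (endpoint p) = shapeDensities q.1 (endpoint q) :=
    congrArg Subtype.val hpq
  obtain ⟨f, hf, hfp⟩ := (isEndpoint_endpoint p).exists_isLimitShape
  obtain ⟨g, -, hgq⟩ := (isEndpoint_endpoint q).exists_isLimitShape
  have h1 := (hfp f hf).2
  have h2 := (hgq f (hd ▸ hf)).2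
  have hc := (h1.isEndpoint hf.1).pos
  have hsub : p.1 + -q.1 = 0 := by
    refine eq_zero_of_polyVal_eq_zero hc fun y hy => ?_
    have e := ((uniqueDiffOn_Icc hc) y hy).eq_deriv _ (h1.2 y hy).2 (h2.2 y hy).2
    rw [one_div, one_div, inv_inj, sub_right_inj, Real.exp_eq_exp] at e
    rw [polyVal_add, polyVal_neg]
    exact sub_eq_zero.2 e
  exact Subtype.ext (add_neg_eq_zero.1 hsub)

theorem surjective_polyDensities : Function.Surjective (polyDensities (k := k)) := by
  rintro ⟨δ, hδ⟩
  obtain ⟨a, ha, hd⟩ := exists_shapeDensities_eq hδ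
  refine ⟨⟨a, ha.coeff_zero_neg⟩, Subtype.ext ?_⟩
  have := (isEndpoint_endpoint (⟨a, ha.coeff_zero_neg⟩ : NegPoly k)).unique ha
  change shapeDensities a (endpoint ⟨a, ha.coeff_zero_neg⟩) = δ
  rw [this, hd]

/-! ### Properness and continuity of the inverse map -/

theorem norm_le_of_coercive (h : IsEndpoint a c) {C : ℝ} (hC : 0 ≤ C)
    (hco : ‖-a‖ ≤ C * momentFun (shapeDensities a c) (-a)) : ‖a‖ ≤ C := by
  rw [norm_neg, momentFun_shapeDensities h] at hco
  have h1 : ∫ y in (0 : ℝ)..c, polyVal (-a) y * bose (polyVal a y) ≤ ∫ _y in (0 : ℝ)..c, (1 : ℝ) :=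
    intervalIntegral.integral_mono_on h.nonneg
      (intervalIntegrable_bose h.nonneg h.neg (continuous_polyVal_right _))
      intervalIntegrable_const fun y hy => by
        rw [polyVal_neg]; exact neg_mul_bose_le (h.neg y hy)
  simp only [intervalIntegral.integral_const, sub_zero, smul_eq_mul, mul_one] at h1
  exact hco.trans (mul_le_of_le_one_right hC (h1.trans h.le_one))

/-- The homeomorphism from polynomials to density vectors. -/
noncomputable def polyDensitiesEquiv (k : ℕ) : NegPoly k ≃ momentInterior k :=
  Equiv.ofBijective polyDensities ⟨injective_polyDensities, surjective_polyDensities⟩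

theorem polyDensitiesEquiv_symm_spec (δ : momentInterior k) :
    IsEndpoint ((polyDensitiesEquiv k).symm δ).1 (1 - δ.1 0) ∧
      shapeDensities ((polyDensitiesEquiv k).symm δ).1 (1 - δ.1 0) = δ.1 := by
  set p := (polyDensitiesEquiv k).symm δ with hp
  have h1 : polyDensities p = δ := (polyDensitiesEquiv k).apply_symm_apply δ
  have h2 : shapeDensities p.1 (endpoint p) = δ.1 := congrArg Subtype.val h1
  have h3 := isEndpoint_endpoint p
  have h4 : endpoint p = 1 - δ.1 0 := by
    rw [← h2, shapeDensities_zero h3]; ring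
  rw [← h4]
  exact ⟨h3, h2⟩

theorem continuous_polyDensitiesEquiv_symm : Continuous (polyDensitiesEquiv k).symm := by
  rw [continuous_iff_continuousAt]
  intro δ
  rw [ContinuousAt, tendsto_subtype_rng]
  have hδ : δ.1 ∈ interior (feasible k) := by rw [interior_feasible]; exact δ.2
  obtain ⟨r, hr, hball⟩ := Metric.nhds_basis_closedBall.mem_iff.1
    (mem_interior_iff_mem_nhds.1 hδ)
  -- Every `d` within `r / 2` of `δ` is the centre of a feasible ball of radius `r / 2`, so a single
  -- `C` bounds all nearby preimages; injectivity then leaves only one cluster point.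
  obtain ⟨C, hC, hco⟩ := exists_coercive_of_closedBall k (half_pos hr)
  refine (isCompact_closedBall (0 : Fin (k + 1) → ℝ) C).tendsto_nhds_of_unique_mapClusterPt
    ?_ fun b _ hb => ?_
  · filter_upwards [Metric.closedBall_mem_nhds δ (half_pos hr)] with d hd
    obtain ⟨h1, h2⟩ := polyDensitiesEquiv_symm_spec d
    rw [mem_closedBall_zero_iff]
    refine norm_le_of_coercive h1 hC.le ?_
    rw [h2]
    refine hco d.1 (fun x hx => hball ?_) _ fun y hy => ?_
    · rw [Metric.mem_closedBall] at hx hd ⊢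
      have hd' : dist d.1 δ.1 ≤ r / 2 := hd
      linarith [dist_triangle x d.1 δ.1]
    · rw [polyVal_neg]; linarith [h1.neg y hy]
  · obtain ⟨U, hU, hUb⟩ := mapClusterPt_iff_ultrafilter.1 hb
    have hval : Tendsto (fun d : momentInterior k => d.1) U (𝓝 δ.1) :=
      (continuous_subtype_val.tendsto δ).mono_left hU
    have hc : Tendsto (fun d : momentInterior k => 1 - d.1 0) U (𝓝 (1 - δ.1 0)) :=
      (((continuous_apply 0).tendsto δ.1).comp hval).const_sub 1
    have h := IsEndpoint.of_tendsto hUb hc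
      (Eventually.of_forall fun d => (polyDensitiesEquiv_symm_spec d).1)
      (Or.inl (by linarith [δ.2.2.1]))
    have h3 : shapeDensities b (1 - δ.1 0) = δ.1 := by
      refine tendsto_nhds_unique h.2 (hval.congr fun d => ?_)
      exact (polyDensitiesEquiv_symm_spec d).2.symm
    have h4 : (polyDensitiesEquiv k) ⟨b, h.1.coeff_zero_neg⟩ = δ := by
      refine Subtype.ext ?_
      have := (isEndpoint_endpoint (⟨b, h.1.coeff_zero_neg⟩ : NegPoly k)).unique h.1
      change shapeDensities b (endpoint ⟨b, h.1.coeff_zero_neg⟩) = δ.1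
      rw [this, h3]
    have h5 := congrArg (polyDensitiesEquiv k).symm h4
    rw [Equiv.symm_apply_apply] at h5
    exact congrArg Subtype.val h5

/-- The homeomorphism from polynomials to interior density vectors. -/
noncomputable def polyDensitiesHomeo (k : ℕ) : NegPoly k ≃ₜ momentInterior k where
  toEquiv := polyDensitiesEquiv k
  continuous_toFun := continuous_polyDensities
  continuous_invFun := continuous_polyDensitiesEquiv_symm

theorem exists_homeomorph (k : ℕ) :
    ∃ Φ : NegPoly k ≃ₜ interior (feasible k), ∀ p : NegPoly k,
      (∃ f, IsSublebesgue f ∧ HasInverseSlope f p) ∧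
      (∀ f, IsSublebesgue f → HasInverseSlope f p → densities k f = (Φ p : Fin (k + 1) → ℝ)) := by
  rw [interior_feasible]
  refine ⟨polyDensitiesHomeo k, fun p => ⟨?_, fun f hf hfp => ?_⟩⟩
  · obtain ⟨f, hf, hfp⟩ := (isEndpoint_endpoint p).exists_isLimitShape
    exact ⟨f, hf.1, (hfp f hf).2⟩
  · rw [hfp.densities_eq hf, (hfp.isEndpoint hf).unique (isEndpoint_endpoint p)]
    rfl

end Interior

section Boundary

open Filter Topology

variable {k : ℕ} {f g : ℝ → ℝ} {δ : Fin (k + 1) → ℝ}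

/-! ### The boundary of the feasible region -/

/-- Feasibility makes the functional nonnegative, so strict positivity can fail only by vanishing.
If `δ 0 = 0`, the constant `1` is annihilated. -/
theorem exists_null_poly (hδ : δ ∈ feasible k) (hδ' : δ ∉ momentInterior k) (h1 : δ 0 < 1) :
    ∃ a : Fin (k + 1) → ℝ, a ≠ 0 ∧ (∀ y ∈ Icc 0 (1 - δ 0), 0 ≤ polyVal a y) ∧
      momentFun δ a = 0 := by
  rcases (hδ.1 0).1.eq_or_lt with h0 | h0
  · refine ⟨Pi.single 0 1, by simp, fun y _ => ?_, ?_⟩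
    · rw [polyVal_single]; simp
    · rw [momentFun_single, ← h0]; simp
  · simp only [momentInterior, mem_ofPred_eq, h0, h1, true_and] at hδ'
    push Not at hδ'
    obtain ⟨a, ha, hpos, hle⟩ := hδ'
    exact ⟨a, ha, hpos, le_antisymm hle (momentFun_nonneg hδ hpos)⟩

theorem IsSublebesgue.ae_null (hf : IsSublebesgue f) {a : Fin (k + 1) → ℝ}
    (hpos : ∀ y ∈ Icc 0 (distrib f 1), 0 ≤ polyVal a y)
    (h0 : momentFun (densities k f) a = 0) :
    ∀ᵐ x, x ∈ Icc (0 : ℝ) 1 → polyVal a (distrib f x) = 0 ∨ f x = 1 := by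
  rw [← hf.integral_polyVal, intervalIntegral.integral_eq_zero_iff_of_le_of_nonneg_ae zero_le_one
    ?_ (hf.intervalIntegrable_comp_distrib_mul (continuous_polyVal_right a).continuousOn
      hf.one_sub), Measure.restrict_congr_set Ioc_ae_eq_Icc, EventuallyEq,
      ae_restrict_iff' measurableSet_Icc] at h0
  · filter_upwards [h0] with x hx hxI
    refine (mul_eq_zero.1 (hx hxI)).imp_right fun h => ?_
    linarith
  · filter_upwards [ae_restrict_mem measurableSet_Ioc] with x hx
    have hxI : x ∈ Icc (0 : ℝ) 1 := ⟨hx.1.le, hx.2⟩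
    exact mul_nonneg (hpos _ (hf.distrib_mem hxI)) (hf.one_sub.2 x hxI).1

/-- The last point of `[0,1]` where the distribution function is at most `y`. -/
noncomputable def lastLE (f : ℝ → ℝ) (y : ℝ) : ℝ := sSup {x | x ∈ Icc (0 : ℝ) 1 ∧ distrib f x ≤ y}

theorem le_lastLE {x y : ℝ} (hx : x ∈ Icc (0 : ℝ) 1)
    (hxy : distrib f x ≤ y) : x ≤ lastLE f y :=
  le_csSup ⟨1, fun _ h => h.1.2⟩ ⟨hx, hxy⟩

theorem IsSublebesgue.lastLE_mem (hf : IsSublebesgue f) {y : ℝ}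
    (hy : y ∈ Icc 0 (distrib f 1)) :
    lastLE f y ∈ Icc (0 : ℝ) 1 ∧ distrib f (lastLE f y) = y := by
  set S := {x | x ∈ Icc (0 : ℝ) 1 ∧ distrib f x ≤ y} with hS
  have hcl : IsClosed S :=
    hf.continuousOn_distrib.preimage_isClosed_of_isClosed isClosed_Icc isClosed_Iic
  have hmem : lastLE f y ∈ S :=
    hcl.csSup_mem ⟨0, by simp, by rw [distrib_zero]; exact hy.1⟩ ⟨1, fun _ h => h.1.2⟩
  refine ⟨hmem.1, ?_⟩
  have h1 := hf.invDistrib_mem hy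
  refine le_antisymm hmem.2 ?_
  calc y = distrib f (invDistrib f y) := h1.2.symm
    _ ≤ _ := hf.distrib_mono h1.1.1 (le_lastLE h1.1 h1.2.le) hmem.1.2

/-- Reduces the right inverse of `distrib f`, and hence `f`, to the mass of `(1 - f) dx` below each
level. -/
theorem IsSublebesgue.lastLE_eq_add (hf : IsSublebesgue f) {y : ℝ}
    (hy : y ∈ Icc 0 (distrib f 1)) :
    lastLE f y = y + ∫ x in (0 : ℝ)..lastLE f y, (1 - f x) := by
  obtain ⟨h1, h2⟩ := hf.lastLE_mem hy
  rw [intervalIntegral.integral_sub intervalIntegrable_const (hf.intervalIntegrable (by simp) h1)]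
  change _ = y + ((∫ _ in (0 : ℝ)..lastLE f y, (1 : ℝ)) - distrib f (lastLE f y))
  rw [h2]; simp

theorem exists_polyVal_eq {q : Polynomial ℝ} (hq : q.natDegree ≤ k) :
    ∃ b : Fin (k + 1) → ℝ, ∀ y, polyVal b y = q.eval y := by
  refine ⟨fun i => q.coeff i, fun y => ?_⟩
  rw [Polynomial.eval_eq_sum_range' (Nat.lt_succ_of_le hq),
    ← Fin.sum_univ_eq_sum_range (fun i => q.coeff i * y ^ i)]
  rfl

/-- When the measure `(1 - f) dx` lives on finitely many level sets, its mass below a level is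
determined by the densities. -/
theorem exists_integral_eq_momentFun {a : Fin (k + 1) → ℝ} (ha : a ≠ 0) (y : ℝ) :
    ∃ b : Fin (k + 1) → ℝ, ∀ f, IsSublebesgue f → y ∈ Icc 0 (distrib f 1) →
      (∀ᵐ x, x ∈ Icc (0 : ℝ) 1 → polyVal a (distrib f x) = 0 ∨ f x = 1) →
      ∫ x in (0 : ℝ)..lastLE f y, (1 - f x) = momentFun (densities k f) b := by
  classical
  set Z := (toPoly a).roots.toFinset with hZ
  -- On the at most `k` roots of `a`, the indicator of `(-∞, y]` agrees with a polynomial of degree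
  -- at most `k`; integrating it against `(1 - f) dx` is a moment.
  set q := Lagrange.interpolate Z id fun z => if z ≤ y then (1 : ℝ) else 0 with hq
  have hcard : Z.card ≤ k := (Multiset.toFinset_card_le _).trans
    ((Polynomial.card_roots' _).trans (natDegree_toPoly_le a))
  have hdeg : q.natDegree ≤ k := by
    refine Polynomial.natDegree_le_of_degree_le ?_
    exact (Lagrange.degree_interpolate_lt _ Function.injective_id.injOn).le.trans
      (by exact_mod_cast hcard)
  obtain ⟨b, hb⟩ := exists_polyVal_eq hdeg
  refine ⟨b, fun f hf hy hnull => ?_⟩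
  have hval : ∀ z, polyVal a z = 0 → polyVal b z = if z ≤ y then 1 else 0 := by
    intro z hz
    rw [hb, hq]
    refine Lagrange.eval_interpolate_at_node (v := id) (i := z) _ Function.injective_id.injOn ?_
    rw [hZ, Multiset.mem_toFinset, Polynomial.mem_roots (toPoly_ne_zero ha),
      Polynomial.IsRoot.def, eval_toPoly, hz]
  obtain ⟨h1, h2⟩ := hf.lastLE_mem hy
  have hi := hf.intervalIntegrable_comp_distrib_mul (continuous_polyVal_right b).continuousOn
    hf.one_sub
  rw [← hf.integral_polyVal, ← intervalIntegral.integral_add_adjacent_intervals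
    (hi.mono_set (uIcc_subset_uIcc left_mem_uIcc (by rwa [uIcc_of_le zero_le_one])))
    (hi.mono_set (uIcc_subset_uIcc (by rwa [uIcc_of_le zero_le_one]) right_mem_uIcc))]
  have e1 : ∫ x in (0 : ℝ)..lastLE f y, polyVal b (distrib f x) * (1 - f x) =
      ∫ x in (0 : ℝ)..lastLE f y, (1 - f x) := by
    refine intervalIntegral.integral_congr_ae ?_
    filter_upwards [hnull] with x hx hxI
    rw [uIoc_of_le h1.1] at hxI
    rcases hx ⟨hxI.1.le, hxI.2.trans h1.2⟩ with h | h
    · rw [hval _ h, if_pos, one_mul]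
      rw [← h2]
      exact hf.distrib_mono hxI.1.le hxI.2 h1.2
    · simp [h]
  have e2 : ∫ x in lastLE f y..1, polyVal b (distrib f x) * (1 - f x) =
      ∫ x in lastLE f y..1, (0 : ℝ) := by
    refine intervalIntegral.integral_congr_ae ?_
    filter_upwards [hnull] with x hx hxI
    rw [uIoc_of_le h1.2] at hxI
    have hx1 : x ∈ Icc (0 : ℝ) 1 := ⟨h1.1.trans hxI.1.le, hxI.2⟩
    rcases hx hx1 with h | h
    · rw [hval _ h, if_neg, zero_mul]
      exact fun hle => absurd (le_lastLE hx1 hle) (not_le.2 hxI.1)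
    · simp [h]
  rw [e1, e2]
  simp

theorem distrib_le_of_lastLE_eq (hf : IsSublebesgue f) (hg : IsSublebesgue g)
    (h1 : distrib f 1 = distrib g 1)
    (h : ∀ y ∈ Icc 0 (distrib f 1), lastLE f y = lastLE g y) {x : ℝ} (hx : x ∈ Icc (0 : ℝ) 1) :
    distrib g x ≤ distrib f x := by
  have hm := hf.distrib_mem hx
  obtain ⟨h3, h4⟩ := hg.lastLE_mem (h1 ▸ hm)
  rw [← h4]
  refine hg.distrib_mono hx.1 ?_ h3.2
  rw [← h _ hm]
  exact le_lastLE hx le_rfl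

theorem sameMeasure_of_null (hf : IsSublebesgue f) (hg : IsSublebesgue g)
    {a : Fin (k + 1) → ℝ} (ha : a ≠ 0)
    (hpos : ∀ y ∈ Icc 0 (1 - δ 0), 0 ≤ polyVal a y) (h0 : momentFun δ a = 0)
    (hfd : densities k f = δ) (hgd : densities k g = δ) : SameMeasure f g := by
  have hf1 : distrib f 1 = 1 - δ 0 := by rw [← hfd, hf.distrib_one k]
  have hg1 : distrib g 1 = 1 - δ 0 := by rw [← hgd, hg.distrib_one k]
  have hfn := hf.ae_null (by rwa [hf1]) (hfd.symm ▸ h0)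
  have hgn := hg.ae_null (by rwa [hg1]) (hgd.symm ▸ h0)
  have hlast : ∀ y ∈ Icc 0 (1 - δ 0), lastLE f y = lastLE g y := by
    intro y hy
    obtain ⟨b, hb⟩ := exists_integral_eq_momentFun ha y
    rw [hf.lastLE_eq_add (hf1.symm ▸ hy), hg.lastLE_eq_add (hg1.symm ▸ hy),
      hb f hf (hf1.symm ▸ hy) hfn, hb g hg (hg1.symm ▸ hy) hgn, hfd, hgd]
  refine sameMeasure_of_distrib_eq hf hg fun x hx => le_antisymm ?_ ?_
  · exact distrib_le_of_lastLE_eq hg hf (hg1.trans hf1.symm)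
      (fun y hy => (hlast y (hg1 ▸ hy)).symm) hx
  · exact distrib_le_of_lastLE_eq hf hg (hf1.trans hg1.symm) (fun y hy => hlast y (hf1 ▸ hy)) hx

/-! ### Root counting and the step structure -/

/-- A nonnegative polynomial on `[0, c]` has double roots inside, which bounds their number. -/
theorem card_roots_le {p : Polynomial ℝ} (hp : p ≠ 0) {c : ℝ} (hpos : ∀ y ∈ Icc 0 c, 0 ≤ p.eval y)
    {R : Finset ℝ} (hR : ∀ z ∈ R, z ∈ Icc 0 c ∧ p.IsRoot z) :
    2 * R.card ≤ p.natDegree + (R ∩ {0, c}).card := by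
  classical
  have hmult : ∀ z ∈ R, 2 ≤ p.rootMultiplicity z + if z ∈ ({0, c} : Finset ℝ) then 1 else 0 := by
    intro z hz
    obtain ⟨hzI, hzr⟩ := hR z hz
    have h1 : 1 ≤ p.rootMultiplicity z := (Polynomial.rootMultiplicity_pos hp).2 hzr
    split_ifs with h
    · omega
    · simp only [Finset.mem_insert, Finset.mem_singleton, not_or] at h
      have hmin : IsLocalMin (fun y => p.eval y) z := by
        filter_upwards [Icc_mem_nhds (lt_of_le_of_ne hzI.1 (Ne.symm h.1))
          (lt_of_le_of_ne hzI.2 h.2)] with y hy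
        rw [hzr.eq_zero]
        exact hpos y hy
      have hd : p.derivative.eval z = 0 := hmin.hasDerivAt_eq_zero (p.hasDerivAt z)
      have := (Polynomial.one_lt_rootMultiplicity_iff_isRoot hp).2 ⟨hzr, hd⟩
      omega
  have hsum := Finset.sum_le_sum hmult
  rw [Finset.sum_const, smul_eq_mul, Finset.sum_add_distrib, Finset.sum_ite_mem,
    Finset.sum_const, smul_eq_mul, mul_one] at hsum
  have hle : ∑ z ∈ R, p.rootMultiplicity z ≤ p.natDegree := by
    calc ∑ z ∈ R, p.rootMultiplicity z = ∑ z ∈ R, p.roots.count z := by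
          simp [Polynomial.count_roots]
      _ ≤ ∑ z ∈ p.roots.toFinset, p.roots.count z := by
          refine Finset.sum_le_sum_of_subset fun z hz => ?_
          rw [Multiset.mem_toFinset, Polynomial.mem_roots hp]
          exact (hR z hz).2
      _ = Multiset.card p.roots := Multiset.toFinset_sum_count_eq _
      _ ≤ p.natDegree := Polynomial.card_roots' p
  omega

/-- The exceptional set is that of non-differentiability of `distrib f`, so it does not depend on
`l` and `r`. -/
theorem IsSublebesgue.ae_eq_zero_of_distrib_eq (hf : IsSublebesgue f) :
    ∀ᵐ x, x ∈ Icc (0 : ℝ) 1 → ∀ l r : ℝ, 0 ≤ l → r ≤ 1 → x ∈ Ioo l r →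
      distrib f l = distrib f r → f x = 0 := by
  filter_upwards [hf.ae_hasDerivAt_distrib] with x hx hxI l r hl hr hxlr heq
  refine (hx hxI).unique ((hasDerivAt_const x (distrib f l)).congr_of_eventuallyEq ?_)
  filter_upwards [Ioo_mem_nhds hxlr.1 hxlr.2] with y hy
  refine le_antisymm ?_ (hf.distrib_mono hl hy.1.le (hy.2.le.trans hr))
  rw [heq]
  exact hf.distrib_mono (hl.trans hy.1.le) hy.2.le hr

/-- Off the level sets of the roots of `a` one has `f = 1` a.e., and on a level set of positive
length `f = 0` a.e. The zero intervals are thus the level sets over the set `R` of roots whose level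
set is nondegenerate, and `2|R| ≤ k + |R ∩ {0, c}| ≤ k + 2`. -/
theorem IsSublebesgue.exists_step_of_null (hf : IsSublebesgue f) {a : Fin (k + 1) → ℝ}
    (ha : a ≠ 0) (hpos : ∀ y ∈ Icc 0 (distrib f 1), 0 ≤ polyVal a y)
    (h0 : momentFun (densities k f) a = 0) (hc : 0 < distrib f 1) :
    ∃ (n : ℕ) (s t : Fin n → ℝ), IsZeroOneStep f s t ∧ (n : ℝ) ≤ (k : ℝ) / 2 + 1 ∧
      ((n : ℝ) = (k : ℝ) / 2 + 1 → (∃ i, s i = 0) ∧ (∃ j, t j = 1)) := by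
  classical
  set c := distrib f 1 with hcdef
  set R := (toPoly a).roots.toFinset.filter
    fun z => z ∈ Icc 0 c ∧ invDistrib f z < lastLE f z with hR
  have hRmem : ∀ z, z ∈ R ↔ polyVal a z = 0 ∧ z ∈ Icc 0 c ∧ invDistrib f z < lastLE f z := by
    intro z
    rw [hR, Finset.mem_filter, Multiset.mem_toFinset, Polynomial.mem_roots (toPoly_ne_zero ha),
      Polynomial.IsRoot.def, eval_toPoly]
  have hcard := card_roots_le (toPoly_ne_zero ha) (c := c) (R := R)
    (fun y hy => by rw [eval_toPoly]; exact hpos y hy)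
    (fun z hz => ⟨((hRmem z).1 hz).2.1, by
      rw [Polynomial.IsRoot.def, eval_toPoly]; exact ((hRmem z).1 hz).1⟩)
  have hdeg := natDegree_toPoly_le a
  have hpair : ({0, c} : Finset ℝ).card = 2 := Finset.card_pair hc.ne
  have hcap : (R ∩ {0, c}).card ≤ 2 := by
    rw [← hpair]; exact Finset.card_le_card Finset.inter_subset_right
  set e := R.orderEmbOfFin rfl with he
  have heR : ∀ i, e i ∈ R := fun i => R.orderEmbOfFin_mem rfl i
  have hsurj : ∀ z ∈ R, ∃ i, e i = z := by
    intro z hz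
    have : z ∈ range e := by rw [he, Finset.range_orderEmbOfFin]; exact hz
    exact this
  refine ⟨R.card, fun i => invDistrib f (e i), fun i => lastLE f (e i), ⟨?_, ?_, ?_⟩, ?_, ?_⟩
  · intro i
    obtain ⟨-, h2, h3⟩ := (hRmem _).1 (heR i)
    exact ⟨(hf.invDistrib_mem h2).1.1, h3, (hf.lastLE_mem h2).1.2⟩
  · intro i j hij
    have h1 := hf.lastLE_mem ((hRmem _).1 (heR i)).2.1
    have h2 := hf.invDistrib_mem ((hRmem _).1 (heR j)).2.1
    by_contra! hle
    have h3 := hf.distrib_mono h2.1.1 hle h1.1.2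
    rw [h1.2, h2.2] at h3
    exact absurd (e.strictMono hij) (not_lt.2 h3)
  · have hfin : ∀ s : Finset ℝ, ∀ᵐ x : ℝ, x ∉ s := fun s => by
      filter_upwards [s.countable_toSet.ae_notMem volume] with x hx
      exact fun h => hx (Finset.mem_coe.2 h)
    rw [SameMeasure, ae_restrict_iff' measurableSet_Icc]
    filter_upwards [hf.ae_null hpos h0, hf.ae_eq_zero_of_distrib_eq,
      hfin ((toPoly a).roots.toFinset.image (invDistrib f)),
      hfin ((toPoly a).roots.toFinset.image (lastLE f))]
      with x hx hx0 hxlo hxhi hxI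
    have hroot : ∀ z, polyVal a z = 0 → x ≠ invDistrib f z ∧ x ≠ lastLE f z := by
      intro z hz
      have hzr : z ∈ (toPoly a).roots.toFinset := by
        rw [Multiset.mem_toFinset, Polynomial.mem_roots (toPoly_ne_zero ha),
          Polynomial.IsRoot.def, eval_toPoly, hz]
      exact ⟨fun h => hxlo (h ▸ Finset.mem_image_of_mem _ hzr),
        fun h => hxhi (h ▸ Finset.mem_image_of_mem _ hzr)⟩
    by_cases hmem : x ∈ ⋃ i, Ico (invDistrib f (e i)) (lastLE f (e i))
    · rw [indicator_of_notMem (by simpa using hmem)]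
      obtain ⟨i, hi⟩ := mem_iUnion.1 hmem
      obtain ⟨h1, h2, -⟩ := (hRmem _).1 (heR i)
      have h3 := hf.invDistrib_mem h2
      have h4 := hf.lastLE_mem h2
      exact hx0 hxI _ _ h3.1.1 h4.1.2 ⟨lt_of_le_of_ne hi.1 (hroot _ h1).1.symm, hi.2⟩
        (h3.2.trans h4.2.symm)
    · rw [indicator_of_mem (by simpa using hmem)]
      refine (hx hxI).resolve_left fun hz => hmem ?_
      have h2 := hf.distrib_mem hxI
      have h5 : invDistrib f (distrib f x) ≤ x := csInf_le ⟨0, fun _ h => h.1.1⟩ ⟨hxI, le_rfl⟩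
      have h6 : x < lastLE f (distrib f x) :=
        lt_of_le_of_ne (le_lastLE hxI le_rfl) (hroot _ hz).2
      obtain ⟨i, hi⟩ := hsurj (distrib f x) ((hRmem _).2 ⟨hz, h2, h5.trans_lt h6⟩)
      exact mem_iUnion.2 ⟨i, by rw [hi]; exact ⟨h5, h6⟩⟩
  · have h : 2 * R.card ≤ k + 2 := by omega
    have : (2 : ℝ) * R.card ≤ k + 2 := by exact_mod_cast h
    linarith
  · intro heq
    have h : 2 * R.card = k + 2 := by
      have : (2 : ℝ) * R.card = k + 2 := by rw [heq]; ring
      exact_mod_cast this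
    -- Equality in the count forces both ends of `[0, c]` into `R`; their level sets are the first
    -- and the last step.
    have hsub : ({0, c} : Finset ℝ) ⊆ R := by
      rw [← Finset.inter_eq_right]
      exact Finset.eq_of_subset_of_card_le Finset.inter_subset_right (by omega)
    obtain ⟨i, hi⟩ := hsurj 0 (hsub (by simp))
    obtain ⟨j, hj⟩ := hsurj c (hsub (by simp))
    refine ⟨⟨i, by simp only [hi, invDistrib_zero]⟩, ⟨j, ?_⟩⟩
    simp only [hj]
    exact le_antisymm (hf.lastLE_mem ⟨hc.le, le_rfl⟩).1.2
      (le_lastLE (by simp) le_rfl)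

theorem IsSublebesgue.sameMeasure_zero (hf : IsSublebesgue f) (h : distrib f 1 = 0) :
    SameMeasure f 0 := by
  refine sameMeasure_of_distrib_eq hf ⟨measurable_const, fun x _ => by simp⟩ fun x hx => ?_
  have := hf.distrib_mem hx
  rw [h] at this
  rw [le_antisymm this.2 this.1]
  simp [distrib]

theorem isZeroOneStep_of_sameMeasure_zero (h : SameMeasure f 0) :
    IsZeroOneStep f (fun _ : Fin 1 => 0) fun _ => 1 := by
  refine ⟨fun _ => by simp, fun i j hij => absurd hij (by simp [Subsingleton.elim i j]), ?_⟩
  have h1 : ∀ᵐ x : ℝ ∂(volume.restrict (Icc (0 : ℝ) 1)), x ≠ 1 :=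
    ae_restrict_of_ae (by simp [ae_iff, measure_singleton])
  filter_upwards [h, h1, ae_restrict_mem measurableSet_Icc] with x hx hx1 hxI
  rw [indicator_of_notMem, hx, Pi.zero_apply]
  simpa using ⟨hxI.1, lt_of_le_of_ne hxI.2 hx1⟩

theorem frontier_feasible_spec (hδ : δ ∈ frontier (feasible k)) :
    (∃ f, IsSublebesgue f ∧ densities k f = δ) ∧
      (∀ f g, IsSublebesgue f → IsSublebesgue g → densities k f = δ → densities k g = δ →
        SameMeasure f g) ∧
      (∀ f, IsSublebesgue f → densities k f = δ →
        ∃ (n : ℕ) (s t : Fin n → ℝ), IsZeroOneStep f s t ∧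
          (n : ℝ) ≤ (k : ℝ) / 2 + 1 ∧
          ((n : ℝ) = (k : ℝ) / 2 + 1 → (∃ i, s i = 0) ∧ (∃ j, t j = 1))) := by
  rw [(isClosed_feasible k).frontier_eq, interior_feasible] at hδ
  have hF : ∀ f, IsSublebesgue f → densities k f = δ → distrib f 1 = 1 - δ 0 :=
    fun f hf hd => by rw [← hd, hf.distrib_one k]
  refine ⟨mem_feasible.1 hδ.1, ?_⟩
  -- If `δ 0 = 1`, then `c = 0`: the interval `[0, c]` is a point and the root count breaks down,
  -- but `f = 0` a.e., with a single zero interval reaching both ends.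
  rcases (hδ.1.1 0).2.eq_or_lt with h1 | h1
  · have hz : ∀ f, IsSublebesgue f → densities k f = δ → SameMeasure f 0 :=
      fun f hf hd => hf.sameMeasure_zero (by rw [hF f hf hd, h1, sub_self])
    refine ⟨fun f g hf hg hfd hgd => (hz f hf hfd).trans (hz g hg hgd).symm,
      fun f hf hd => ⟨1, _, _, isZeroOneStep_of_sameMeasure_zero (hz f hf hd), ?_,
        fun _ => ⟨⟨0, rfl⟩, ⟨0, rfl⟩⟩⟩⟩
    have : (0 : ℝ) ≤ k := Nat.cast_nonneg k
    push_cast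
    linarith
  · obtain ⟨a, ha, hpos, h0⟩ := exists_null_poly hδ.1 hδ.2 h1
    refine ⟨fun f g hf hg hfd hgd => sameMeasure_of_null hf hg ha hpos h0 hfd hgd,
      fun f hf hd => ?_⟩
    have hc := hF f hf hd
    exact hf.exists_step_of_null ha (by rwa [hc]) (by rwa [hd]) (by rw [hc]; linarith)

end Boundary

end PatternDensity

open PatternDensity
theorem mainTheorem4 (k : ℕ) :
    -- entropy maximizers with densities in the interior of the feasible region
    (∀ δ ∈ interior (feasible k),
      (∃ f, IsLimitShape k δ f) ∧
      (∀ f g, IsLimitShape k δ f → IsLimitShape k δ g → SameMeasure f g) ∧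
      (∀ f, IsLimitShape k δ f → ∃ p : NegPoly k, HasInverseSlope f p)) ∧
    -- the map from polynomials to densities
    (∃ Φ : NegPoly k ≃ₜ interior (feasible k), ∀ p : NegPoly k,
      (∃ f, IsSublebesgue f ∧ HasInverseSlope f p) ∧
      (∀ f, IsSublebesgue f → HasInverseSlope f p → densities k f = (Φ p : Fin (k + 1) → ℝ))) ∧
    -- the boundary of the feasible region
    (∀ δ ∈ frontier (feasible k),
      (∃ f, IsSublebesgue f ∧ densities k f = δ) ∧
      (∀ f g, IsSublebesgue f → IsSublebesgue g → densities k f = δ → densities k g = δ →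
        SameMeasure f g) ∧
      (∀ f, IsSublebesgue f → densities k f = δ →
        ∃ (n : ℕ) (s t : Fin n → ℝ), IsZeroOneStep f s t ∧
          (n : ℝ) ≤ (k : ℝ) / 2 + 1 ∧
          ((n : ℝ) = (k : ℝ) / 2 + 1 → (∃ i, s i = 0) ∧ (∃ j, t j = 1)))) :=
  ⟨fun _ hδ => limitShape_of_mem_momentInterior (interior_feasible_subset k hδ),
    exists_homeomorph k, fun _ hδ => frontier_feasible_spec hδ⟩
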